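/- Let $\mathbb K=\mathbb R$ or $\mathbb C$ and let $M$ be a (smooth real, respectively complex) manifold of dimension $3$ over $\mathbb K$; all functions, forms and bi-vectors are smooth (holomorphic if $\mathbb K=\mathbb C$). Let $\Lambda,\Lambda_1$ be Poisson structures on $M$, that is, bi-vector fields whose brackets $\{f,g\}=\Lambda(df,dg)$, $\{f,g\}_1=\Lambda_1(df,dg)$ satisfy the Jacobi identity for all locally defined functions. Assume that the couple $(\Lambda,\Lambda_1)$ is generic at each point, i.e. $(a\Lambda+b\Lambda_1)(p)\neq 0$ for all $p\in M$ and all $(a,b)\in\mathbb C^2\setminus\{(0,0)\}$. Let $(\omega,\omega_1,\Omega)$ represent $(\Lambda,\Lambda_1)$: $\omega,\omega_1$ are $1$-forms and $\Omega$ is a nowhere vanishing $3$-form on $M$ such that $$\alpha\wedge\beta\wedge\omega=\Lambda(\alpha,\beta)\,\Omega,\qquad \alpha\wedge\beta\wedge\omega_1=\Lambda_1(\alpha,\beta)\,\Omega$$ for every $p\in M$ and all $\alpha,\beta\in T_p^*M$. Then there exists a $1$-form $\lambda$ on $M$ with $d\omega=\lambda\wedge\omega$ and $d\omega_1=\lambda\wedge\omega_1$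 if and only if $(\Lambda,\Lambda_1)$ is a Poisson pair, i.e. each point of $M$ has an open neighborhood on which $\Lambda$, $\Lambda_1$ and $\Lambda+\Lambda_1$ are Poisson. Moreover, for every such $\lambda$: 1. $\operatorname{Im}\Lambda(p)\cap\operatorname{Im}\Lambda_1(p)\subset\operatorname{Ker} d\lambda(p)$ for every $p\in M$, where $\operatorname{Im}\Lambda(p)=\{\Lambda(\alpha,\cdot):\alpha\in T_p^*M\}\subset T_pM$ and $\operatorname{Ker}d\lambda(p)=\{v\in T_pM: d\lambda(v,w)=0\ \text{for all}\ w\in T_pM\}$; 2. $d\lambda=0$ on $M$ if and only if $(\Lambda,\Lambda_1)$ is flat, i.e. around each point of $M$ there are coordinates in which both $\Lambda$ and $\Lambda_1$ have constant coefficients. -/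

import Mathlib

open scoped Manifold ContDiff

noncomputable section

namespace BiHam

section Fields

variable (𝕜 : Type*) [RCLike 𝕜] (E : Type*) [NormedAddCommGroup E] [NormedSpace 𝕜 E]
  (M : Type*) [TopologicalSpace M] [ChartedSpace E M]

/-- Differential `k`-forms on `M`, not necessarily smooth: an alternating `k`-linear form
on each tangent space. -/
abbrev DiffForm (k : ℕ) : Type _ :=
  (p : M) → TangentSpace 𝓘(𝕜, E) p [⋀^Fin k]→L[𝕜] 𝕜

/-- Bi-vector fields on `M`, not necessarily smooth: an element of `Λ² (T_p M)`, regarded as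
an alternating bilinear form on the cotangent space, for each point `p`. -/
abbrev BivectorField : Type _ :=
  (p : M) → (TangentSpace 𝓘(𝕜, E) p →L[𝕜] 𝕜) [⋀^Fin 2]→L[𝕜] 𝕜

end Fields

variable {𝕜 : Type*} [RCLike 𝕜] {E : Type*} [NormedAddCommGroup E] [NormedSpace 𝕜 E]
  {M : Type*} [TopologicalSpace M] [ChartedSpace E M]

/-! ### Differential forms -/

/-- The exterior product `α ∧ η` of a covector `α` and a `k`-form `η` at `p`:
`(α ∧ η) (v₀, …, v_k) = ∑ i, (-1) ^ i * α v_i * η (v₀, …, v_k without v_i)`. -/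
def wedge {p : M} {k : ℕ} (α : TangentSpace 𝓘(𝕜, E) p →L[𝕜] 𝕜)
    (η : TangentSpace 𝓘(𝕜, E) p [⋀^Fin k]→L[𝕜] 𝕜) :
    TangentSpace 𝓘(𝕜, E) p [⋀^Fin (k + 1)]→L[𝕜] 𝕜 :=
  ContinuousAlternatingMap.alternatizeUncurryFin (𝕜 := 𝕜) (E := E) (F := 𝕜)
    (ContinuousLinearMap.smulRight (M₁ := E) (M₂ := E [⋀^Fin k]→L[𝕜] 𝕜) α η)

namespace DiffForm

/-- A `1`-form at `p` as a covector. -/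
def covector (lam : DiffForm 𝕜 E M 1) (p : M) : TangentSpace 𝓘(𝕜, E) p →L[𝕜] 𝕜 :=
  (ContinuousAlternatingMap.ofSubsingleton 𝕜 (TangentSpace 𝓘(𝕜, E) p) 𝕜 (0 : Fin 1)).symm (lam p)

/-- The expression of a form in a chart `e`: its pullback by `e⁻¹`. Meaningful on `e.target`. -/
def inChart {k : ℕ} (η : DiffForm 𝕜 E M k) (e : OpenPartialHomeomorph M E) (y : E) :
    E [⋀^Fin k]→L[𝕜] 𝕜 :=
  (η (e.symm y)).compContinuousLinearMap (mfderiv 𝓘(𝕜, E) 𝓘(𝕜, E) e.symm y)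

/-- A form is smooth (holomorphic if `𝕜 = ℂ`) if it is so in all charts. -/
def IsSmooth {k : ℕ} (η : DiffForm 𝕜 E M k) : Prop :=
  ∀ e ∈ atlas E M, ContDiffOn 𝕜 ∞ (η.inChart e) e.target

/-- Exterior derivative: at `p` it is computed in the chart at `p`. -/
def d {k : ℕ} (η : DiffForm 𝕜 E M k) : DiffForm 𝕜 E M (k + 1) := fun p =>
  (extDeriv (η.inChart (chartAt E p)) (chartAt E p p)).compContinuousLinearMap
    (mfderiv 𝓘(𝕜, E) 𝓘(𝕜, E) (chartAt E p) p)

/-- The kernel of a `2`-form at `p`. -/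
def ker (η : DiffForm 𝕜 E M 2) (p : M) : Set (TangentSpace 𝓘(𝕜, E) p) :=
  {v | ∀ w : TangentSpace 𝓘(𝕜, E) p, η p ![v, w] = 0}

end DiffForm

/-! ### Bi-vectors and Poisson structures -/

/-- The differential at `p` of a scalar function. -/
def diff (f : M → 𝕜) (p : M) : TangentSpace 𝓘(𝕜, E) p →L[𝕜] 𝕜 :=
  mfderiv 𝓘(𝕜, E) 𝓘(𝕜, 𝕜) f p

namespace BivectorField

/-- The expression of a bi-vector field in a chart `e`: its push-forward by `e`, whose values on
covectors of `E` are obtained by pulling these back by `e`. Meaningful on `e.target`. -/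
def inChart (Λ : BivectorField 𝕜 E M) (e : OpenPartialHomeomorph M E) (y : E) :
    (E →L[𝕜] 𝕜) [⋀^Fin 2]→L[𝕜] 𝕜 :=
  (Λ (e.symm y)).compContinuousLinearMap
    (ContinuousLinearMap.precomp (E := TangentSpace 𝓘(𝕜, E) (e.symm y)) (F := E) 𝕜
      (mfderiv 𝓘(𝕜, E) 𝓘(𝕜, E) e (e.symm y)))

/-- Smoothness (holomorphy if `𝕜 = ℂ`) on an open set `U`. -/
def IsSmoothOn (Λ : BivectorField 𝕜 E M) (U : Set M) : Prop :=
  ∀ e ∈ atlas E M, ContDiffOn 𝕜 ∞ (Λ.inChart e) (e.target ∩ e.symm ⁻¹' U)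

/-- The bracket `{f, g} = Λ(df, dg)`. -/
def bracket (Λ : BivectorField 𝕜 E M) (f g : M → 𝕜) (p : M) : 𝕜 :=
  Λ p ![diff f p, diff g p]

/-- `Λ` is a Poisson structure on the open set `U`: it is smooth there and its bracket satisfies
the Jacobi identity for all locally defined smooth functions. -/
def IsPoissonOn (Λ : BivectorField 𝕜 E M) (U : Set M) : Prop :=
  Λ.IsSmoothOn U ∧
  ∀ V : Set M, IsOpen V → V ⊆ U → ∀ f g h : M → 𝕜,
    ContMDiffOn 𝓘(𝕜, E) 𝓘(𝕜, 𝕜) ∞ f V → ContMDiffOn 𝓘(𝕜, E) 𝓘(𝕜, 𝕜) ∞ g V →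
    ContMDiffOn 𝓘(𝕜, E) 𝓘(𝕜, 𝕜) ∞ h V →
    ∀ p ∈ V, Λ.bracket f (Λ.bracket g h) p + Λ.bracket g (Λ.bracket h f) p +
      Λ.bracket h (Λ.bracket f g) p = 0

/-- `Λ` is a Poisson structure on `M`. -/
def IsPoisson (Λ : BivectorField 𝕜 E M) : Prop :=
  Λ.IsPoissonOn Set.univ

/-- The image of `Λ` at `p`: the vectors `v = Λ(α, ·)`, for `α` a covector at `p`. -/
def im (Λ : BivectorField 𝕜 E M) (p : M) : Set (TangentSpace 𝓘(𝕜, E) p) :=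
  {v | ∃ α : TangentSpace 𝓘(𝕜, E) p →L[𝕜] 𝕜, ∀ β : TangentSpace 𝓘(𝕜, E) p →L[𝕜] 𝕜,
    β v = Λ p ![α, β]}

end BivectorField

/-! ### Couples of bi-vectors -/

/-- The couple is a Poisson pair: around each point, `Λ`, `Λ₁` and `Λ + Λ₁` are Poisson. -/
def IsPoissonPair (Λ Λ₁ : BivectorField 𝕜 E M) : Prop :=
  ∀ p : M, ∃ U : Set M, IsOpen U ∧ p ∈ U ∧ Λ.IsPoissonOn U ∧ Λ₁.IsPoissonOn U ∧
    BivectorField.IsPoissonOn (fun q => Λ q + Λ₁ q) U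

/-- The couple is flat: around each point there are coordinates in which `Λ` and `Λ₁` both have
constant coefficients. -/
def IsFlat (Λ Λ₁ : BivectorField 𝕜 E M) : Prop :=
  ∀ p : M, ∃ e ∈ IsManifold.maximalAtlas 𝓘(𝕜, E) ∞ M, p ∈ e.source ∧
    ∃ c c₁ : (E →L[𝕜] 𝕜) [⋀^Fin 2]→L[𝕜] 𝕜,
      ∀ y ∈ e.target, Λ.inChart e y = c ∧ Λ₁.inChart e y = c₁

/-- Genericity, at each point, of a couple of bi-vectors on a manifold of dimension three:
`a Λ + b Λ₁`, as a complex bi-vector, has no zeros for any `(a, b) ∈ ℂ² ∖ {0}`.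
The map `RCLike.map 𝕜 ℂ` is the inclusion of `𝕜` in `ℂ`. -/
def IsGeneric (Λ Λ₁ : BivectorField 𝕜 E M) : Prop :=
  ∀ (p : M) (a b : ℂ), (a, b) ≠ (0, 0) →
    ∃ α β : TangentSpace 𝓘(𝕜, E) p →L[𝕜] 𝕜,
      a * RCLike.map 𝕜 ℂ (Λ p ![α, β]) + b * RCLike.map 𝕜 ℂ (Λ₁ p ![α, β]) ≠ 0

/-- In dimension three, the `1`-form `w` and the volume form `Ω` represent the bi-vector `Λ`:
`α ∧ β ∧ w = Λ(α, β) Ω` for all covectors `α`, `β`. -/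
def Represents (w : DiffForm 𝕜 E M 1) (Ω : DiffForm 𝕜 E M 3) (Λ : BivectorField 𝕜 E M) : Prop :=
  ∀ (p : M) (α β : TangentSpace 𝓘(𝕜, E) p →L[𝕜] 𝕜),
    wedge α (wedge β (w p)) = Λ p ![α, β] • Ω p

end BiHam

end

/-! Fix a basis of `E`. In a chart, `1`-forms and `2`-forms become triples of functions: the wedge
of two covectors is the cross product, the wedge of a covector with a `2`-form is the dot product,
and `d` is the curl on `1`-forms and the divergence on `2`-forms. Write W, W₁, L for the triples of
ω, ω₁, λ and ρ for the density of Ω. Then ρ Λ(α, β) is the triple product of α, β, W, and dω = λ ∧ ω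
reads curl W = L ⨯ W (`DiffForm.IsSmooth.d_eq_wedge_iff`). Genericity enters only as the linear
independence of W and W₁ (`IsGeneric.cross_components_ne_zero`).

Existence of λ. The Jacobi identity for Λ is the integrability condition W · curl W = 0
(`Represents.jacobi`). Since Ω is common, Λ + Λ₁ is represented by ω + ω₁. Thus being a Poisson pair
amounts to integrability of ω, ω₁ and ω + ω₁, which at each point is the solvability condition of
the linear system curl W = L ⨯ W, curl W₁ = L ⨯ W₁ (`exists_cross_eq`). The solution is unique
(`cross_right_unique`) and given by a rational formula (`eq_of_cross_eq`), so pointwise solutions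
form a smooth λ without gluing.

The kernel. Differentiating dω = λ ∧ ω gives ω ∧ dλ = 0 (`dot_curl_eq_zero_of_extDeriv`), and
likewise for ω₁. A vector v in both images is annihilated by ω and ω₁, so contraction with v makes
dλ(v, ·) proportional to both forms, hence zero.

Flatness. In coordinates where Λ and Λ₁ are constant, ω and ω₁ are ρ times constant forms, so by
uniqueness λ = dρ/ρ, which is closed (`curl_eq_zero_of_smul_eq_grad`). Conversely, if locally λ =
dg, then u = exp(-g) makes uω = dx and uω₁ = dx₁ exact. A function z for which dx, dx₁, dz have
triple product uρ completes coordinates in which u and ρ cancel from both bi-vectors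
(`exists_normalForm`). -/

namespace BiHam

open Matrix Topology

/-! ### Exterior algebra and exterior derivative in a frame of three vectors. -/

section Coordinates

variable {𝕜 : Type*} [RCLike 𝕜] {E : Type*} [NormedAddCommGroup E] [NormedSpace 𝕜 E]

/-- The exterior product of a covector and a `k`-form on a normed space. -/
noncomputable def extMul {k : ℕ} (α : E →L[𝕜] 𝕜) (η : E [⋀^Fin k]→L[𝕜] 𝕜) :
    E [⋀^Fin (k + 1)]→L[𝕜] 𝕜 :=
  ContinuousAlternatingMap.alternatizeUncurryFin (ContinuousLinearMap.smulRight α η)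

/-- The components of a covector in a frame `b`. -/
def covectorCoords (b : Fin 3 → E) (α : E →L[𝕜] 𝕜) : Fin 3 → 𝕜 := fun i => α (b i)

/-- The components of a `1`-form in a frame `b`. -/
def oneCoords (b : Fin 3 → E) (η : E [⋀^Fin 1]→L[𝕜] 𝕜) : Fin 3 → 𝕜 := fun i => η ![b i]

/-- The components of a `2`-form in a frame `b`, ordered as those of a curl. -/
def twoCoords (b : Fin 3 → E) (η : E [⋀^Fin 2]→L[𝕜] 𝕜) : Fin 3 → 𝕜 :=
  ![η ![b 1, b 2], η ![b 2, b 0], η ![b 0, b 1]]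

/-- The curl of a triple of functions with respect to a frame `b`. -/
noncomputable def curl (b : Fin 3 → E) (W : E → Fin 3 → 𝕜) (y : E) : Fin 3 → 𝕜 :=
  ![fderiv 𝕜 W y (b 1) 2 - fderiv 𝕜 W y (b 2) 1,
    fderiv 𝕜 W y (b 2) 0 - fderiv 𝕜 W y (b 0) 2,
    fderiv 𝕜 W y (b 0) 1 - fderiv 𝕜 W y (b 1) 0]

/-- The components of the differential of a function with respect to a frame `b`. -/
noncomputable def grad (b : Fin 3 → E) (f : E → 𝕜) (y : E) : Fin 3 → 𝕜 :=
  covectorCoords b (fderiv 𝕜 f y)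

/-- The triple product of three triples. -/
def triple (a b c : Fin 3 → 𝕜) : 𝕜 := a ⬝ᵥ b ⨯₃ c

theorem triple_apply (a b c : Fin 3 → 𝕜) :
    triple a b c = a 0 * (b 1 * c 2 - b 2 * c 1) + a 1 * (b 2 * c 0 - b 0 * c 2) +
      a 2 * (b 0 * c 1 - b 1 * c 0) := by
  simp only [triple, cross_apply, vec3_dotProduct, cons_val_zero, cons_val_one, cons_val]

theorem extMul_apply_two (α : E →L[𝕜] 𝕜) (η : E [⋀^Fin 1]→L[𝕜] 𝕜) (u v : E) :
    extMul α η ![u, v] = α u * η ![v] - α v * η ![u] := by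
  rw [extMul, ContinuousAlternatingMap.alternatizeUncurryFin_apply]
  have h0 : (Fin.removeNth 0 ![u, v] : Fin 1 → E) = ![v] := by ext i; fin_cases i; rfl
  have h1 : (Fin.removeNth 1 ![u, v] : Fin 1 → E) = ![u] := by ext i; fin_cases i; rfl
  simp [Fin.sum_univ_succ, h0, h1, sub_eq_add_neg]

theorem extMul_apply_three (α : E →L[𝕜] 𝕜) (η : E [⋀^Fin 2]→L[𝕜] 𝕜) (u v z : E) :
    extMul α η ![u, v, z] = α u * η ![v, z] - α v * η ![u, z] + α z * η ![u, v] := by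
  rw [extMul, ContinuousAlternatingMap.alternatizeUncurryFin_apply]
  have h0 : (Fin.removeNth 0 ![u, v, z] : Fin 2 → E) = ![v, z] := by
    ext i; fin_cases i <;> rfl
  have h1 : (Fin.removeNth 1 ![u, v, z] : Fin 2 → E) = ![u, z] := by
    ext i; fin_cases i <;> rfl
  have h2 : (Fin.removeNth 2 ![u, v, z] : Fin 2 → E) = ![u, v] := by
    ext i; fin_cases i <;> rfl
  simp [Fin.sum_univ_succ, h0, h1, h2, sub_eq_add_neg]
  ring

theorem map_swap_two {F : Type*} [NormedAddCommGroup F] [NormedSpace 𝕜 F]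
    (η : F [⋀^Fin 2]→L[𝕜] 𝕜) (u v : F) : η ![u, v] = - η ![v, u] := by
  have := η.toAlternatingMap.map_swap ![v, u] (i := 0) (j := 1) (by decide)
  have h : (![v, u] ∘ Equiv.swap (0 : Fin 2) 1 : Fin 2 → F) = ![u, v] := by
    ext i; fin_cases i <;> simp
  rw [h] at this
  exact this

theorem map_self_two {F : Type*} [NormedAddCommGroup F] [NormedSpace 𝕜 F]
    (η : F [⋀^Fin 2]→L[𝕜] 𝕜) (u : F) : η ![u, u] = 0 :=
  η.map_eq_zero_of_eq ![u, u] (i := 0) (j := 1) rfl (by decide)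

/-- With `twoCoords_extDeriv`, this turns dω = λ ∧ ω into an equation between a curl and a cross
product. -/
theorem twoCoords_extMul (b : Fin 3 → E) (α : E →L[𝕜] 𝕜) (η : E [⋀^Fin 1]→L[𝕜] 𝕜) :
    twoCoords b (extMul α η) = covectorCoords b α ⨯₃ oneCoords b η := by
  simp only [twoCoords, extMul_apply_two, cross_apply, covectorCoords, oneCoords]

theorem extMul_apply_frame (b : Fin 3 → E) (α : E →L[𝕜] 𝕜) (η : E [⋀^Fin 2]→L[𝕜] 𝕜) :
    extMul α η b = covectorCoords b α ⬝ᵥ twoCoords b η := by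
  have hb : b = ![b 0, b 1, b 2] := by ext i; fin_cases i <;> rfl
  have h : extMul α η b = extMul α η ![b 0, b 1, b 2] := congrArg _ hb
  rw [h, extMul_apply_three, map_swap_two η (b 0) (b 2)]
  simp only [vec3_dotProduct, covectorCoords, twoCoords, cons_val_zero, cons_val_one, cons_val]
  ring

theorem extMul_extMul_apply_frame (b : Fin 3 → E) (α β : E →L[𝕜] 𝕜) (η : E [⋀^Fin 1]→L[𝕜] 𝕜) :
    extMul α (extMul β η) b =
      triple (covectorCoords b α) (covectorCoords b β) (oneCoords b η) := by
  rw [extMul_apply_frame, twoCoords_extMul, triple]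

theorem eq_of_oneCoords_eq (b : Module.Basis (Fin 3) 𝕜 E) {η ζ : E [⋀^Fin 1]→L[𝕜] 𝕜}
    (h : oneCoords b η = oneCoords b ζ) : η = ζ := by
  apply ContinuousAlternatingMap.toAlternatingMap_injective
  refine b.ext_alternating fun v _ => ?_
  have := congrFun h (v 0)
  have hv : (fun i => b (v i)) = ![b (v 0)] := by ext i; fin_cases i; rfl
  rw [hv]; exact this

theorem eq_of_twoCoords_eq (b : Module.Basis (Fin 3) 𝕜 E) {η ζ : E [⋀^Fin 2]→L[𝕜] 𝕜}
    (h : twoCoords b η = twoCoords b ζ) : η = ζ := by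
  apply ContinuousAlternatingMap.toAlternatingMap_injective
  refine b.ext_alternating fun v _ => ?_
  have h0 : η ![b 1, b 2] = ζ ![b 1, b 2] := congrFun h 0
  have h1 : η ![b 2, b 0] = ζ ![b 2, b 0] := congrFun h 1
  have h2 : η ![b 0, b 1] = ζ ![b 0, b 1] := congrFun h 2
  have h0' : η ![b 2, b 1] = ζ ![b 2, b 1] := by
    rw [map_swap_two η, map_swap_two ζ, h0]
  have h1' : η ![b 0, b 2] = ζ ![b 0, b 2] := by
    rw [map_swap_two η, map_swap_two ζ, h1]
  have h2' : η ![b 1, b 0] = ζ ![b 1, b 0] := by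
    rw [map_swap_two η, map_swap_two ζ, h2]
  have hv : (fun i => b (v i)) = ![b (v 0), b (v 1)] := by ext i; fin_cases i <;> rfl
  rw [hv]
  change η ![b (v 0), b (v 1)] = ζ ![b (v 0), b (v 1)]
  generalize v 0 = i
  generalize v 1 = j
  fin_cases i <;> fin_cases j <;> simp only [Fin.mk_one, Fin.zero_eta, Fin.reduceFinMk, *] <;>
    rw [map_self_two, map_self_two]

theorem eq_of_apply_basis_eq (b : Module.Basis (Fin 3) 𝕜 E) {η ζ : E [⋀^Fin 3]→L[𝕜] 𝕜}
    (h : η b = ζ b) : η = ζ := by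
  apply ContinuousAlternatingMap.toAlternatingMap_injective
  rw [η.toAlternatingMap.eq_smul_basis_det b, ζ.toAlternatingMap.eq_smul_basis_det b]
  congr 1

theorem differentiableAt_oneCoords (b : Fin 3 → E) {θ : E → E [⋀^Fin 1]→L[𝕜] 𝕜} {y : E}
    (h : DifferentiableAt 𝕜 θ y) : DifferentiableAt 𝕜 (fun z => oneCoords b (θ z)) y :=
  differentiableAt_pi.2 fun _ => h.continuousAlternatingMap_apply_const _

theorem twoCoords_extDeriv (b : Fin 3 → E) {θ : E → E [⋀^Fin 1]→L[𝕜] 𝕜} {y : E}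
    (h : DifferentiableAt 𝕜 θ y) :
    twoCoords b (extDeriv θ y) = curl b (fun z => oneCoords b (θ z)) y := by
  have key : ∀ u v : E, extDeriv θ y ![u, v] =
      fderiv 𝕜 (fun z => θ z ![v]) y u - fderiv 𝕜 (fun z => θ z ![u]) y v := by
    intro u v
    rw [extDeriv_apply h]
    have h0 : (Fin.removeNth 0 ![u, v] : Fin 1 → E) = ![v] := by ext i; fin_cases i; rfl
    have h1 : (Fin.removeNth 1 ![u, v] : Fin 1 → E) = ![u] := by ext i; fin_cases i; rfl
    simp [Fin.sum_univ_succ, h0, h1, sub_eq_add_neg]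
  have hd : ∀ u : E, ∀ i : Fin 3, fderiv 𝕜 (fun z => oneCoords b (θ z)) y u i =
      fderiv 𝕜 (fun z => θ z ![b i]) y u := by
    intro u i
    have := fderiv_pi (𝕜 := 𝕜) (φ := fun i z => oneCoords b (θ z) i) (x := y)
      (fun i => h.continuousAlternatingMap_apply_const _)
    change fderiv 𝕜 (fun z i => oneCoords b (θ z) i) y u i = _
    rw [this]
    rfl
  simp only [twoCoords, curl, key, hd]

/-- The divergence, needed to read d ∘ d = 0 in components. The cyclic order in `twoCoords` absorbs
the alternating signs. -/
theorem extDeriv_two_apply_frame (b : Fin 3 → E) {θ : E → E [⋀^Fin 2]→L[𝕜] 𝕜} {y : E}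
    (h : DifferentiableAt 𝕜 θ y) :
    extDeriv θ y b = fderiv 𝕜 (fun z => twoCoords b (θ z) 0) y (b 0) +
      fderiv 𝕜 (fun z => twoCoords b (θ z) 1) y (b 1) +
      fderiv 𝕜 (fun z => twoCoords b (θ z) 2) y (b 2) := by
  rw [extDeriv_apply h]
  have h0 : (Fin.removeNth 0 b : Fin 2 → E) = ![b 1, b 2] := by
    ext i; fin_cases i <;> rfl
  have h1 : (Fin.removeNth 1 b : Fin 2 → E) = ![b 0, b 2] := by
    ext i; fin_cases i <;> rfl
  have h2 : (Fin.removeNth 2 b : Fin 2 → E) = ![b 0, b 1] := by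
    ext i; fin_cases i <;> rfl
  have h3 : (fun z => θ z ![b 0, b 2]) = fun z => - θ z ![b 2, b 0] :=
    funext fun z => map_swap_two _ _ _
  simp only [Fin.sum_univ_succ, h0, twoCoords]
  simp [h1, h2, h3, fderiv_fun_neg]
  ring

end Coordinates

/-! ### Linear systems for the cross product over a field. -/

section VectorAlgebra

variable {K : Type*} [Field K]

theorem exists_ne_zero_of_cross_ne_zero {a b : Fin 3 → K} (h : a ⨯₃ b ≠ 0) :
    ∃ u : Fin 3 → K, u ⬝ᵥ a ⨯₃ b ≠ 0 := by
  by_contra! hc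
  exact h (dotProduct_eq_zero_iff.1 fun u => by rw [dotProduct_comm]; exact hc u)

/-- The solution of the system `x ⨯₃ a = c`, `x ⨯₃ b = d` in terms of a triple `u` that is
independent of `a` and `b`. -/
theorem eq_of_cross_eq {a b c d u x : Fin 3 → K} (hc : c = x ⨯₃ a) (hd : d = x ⨯₃ b) :
    (u ⬝ᵥ a ⨯₃ b) • x = (c ⬝ᵥ b) • u + (d ⬝ᵥ u) • a - (c ⬝ᵥ u) • b := by
  subst hc hd
  simp only [vec3_dotProduct, cross_apply, cons_val_zero, cons_val_one, cons_val]
  ext i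
  fin_cases i <;> simp <;> ring

/-- Expansion of a triple in the basis reciprocal to `a`, `b`, `u`. -/
theorem smul_eq_dot_smul_cross (a b u x : Fin 3 → K) :
    (u ⬝ᵥ a ⨯₃ b) • x =
      (a ⬝ᵥ x) • (b ⨯₃ u) + (b ⬝ᵥ x) • (u ⨯₃ a) + (u ⬝ᵥ x) • (a ⨯₃ b) := by
  simp only [vec3_dotProduct, cross_apply, cons_val_zero, cons_val_one, cons_val]
  ext i
  fin_cases i <;> simp <;> ring

/-- By linearity the third condition says a · d = -(b · c). These are the relations forced by c = x
⨯ a and d = x ⨯ b, and they suffice when a and b are independent. -/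
theorem exists_cross_eq {a b c d : Fin 3 → K} (h : a ⨯₃ b ≠ 0) (ha : a ⬝ᵥ c = 0)
    (hb : b ⬝ᵥ d = 0) (hab : (a + b) ⬝ᵥ (c + d) = 0) :
    ∃ x : Fin 3 → K, c = x ⨯₃ a ∧ d = x ⨯₃ b := by
  obtain ⟨u, hu⟩ := exists_ne_zero_of_cross_ne_zero h
  have hab' : a ⬝ᵥ d = - (b ⬝ᵥ c) := by
    simp only [add_dotProduct, dotProduct_add, ha, hb] at hab
    linear_combination hab
  -- The only candidate, read off from `eq_of_cross_eq`.
  refine ⟨(u ⬝ᵥ a ⨯₃ b)⁻¹ • ((b ⬝ᵥ c) • u + (u ⬝ᵥ d) • a - (u ⬝ᵥ c) • b), ?_, ?_⟩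
  · rw [LinearMap.map_smul, LinearMap.smul_apply, eq_inv_smul_iff₀ hu, smul_eq_dot_smul_cross, ha]
    simp [sub_eq_add_neg, ← smul_neg, cross_anticomm]
  · rw [LinearMap.map_smul, LinearMap.smul_apply, eq_inv_smul_iff₀ hu, smul_eq_dot_smul_cross, hb,
      hab']
    simp [← smul_neg, cross_anticomm]

/-- `eq_of_cross_eq` recovers x from its two cross products. This is the uniqueness of λ. -/
theorem cross_right_unique {a b x y : Fin 3 → K} (h : a ⨯₃ b ≠ 0) (ha : x ⨯₃ a = y ⨯₃ a)
    (hb : x ⨯₃ b = y ⨯₃ b) : x = y := by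
  obtain ⟨u, hu⟩ := exists_ne_zero_of_cross_ne_zero h
  have h1 := eq_of_cross_eq (u := u) (x := x) (a := a) (b := b) rfl rfl
  have h2 := eq_of_cross_eq (u := u) (x := y) (a := a) (b := b) rfl rfl
  rw [ha, hb, ← h2] at h1
  exact (smul_right_injective _ hu) h1

end VectorAlgebra

/-! ### Vector calculus in a frame, and the Jacobi identity in terms of the curl. -/

section VectorCalculus

variable {𝕜 : Type*} [RCLike 𝕜] {E : Type*} [NormedAddCommGroup E] [NormedSpace 𝕜 E]

theorem grad_eventuallyEq (b : Fin 3 → E) {f g : E → 𝕜} {y : E} (h : f =ᶠ[𝓝 y] g) :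
    grad b f y = grad b g y := by
  rw [grad, grad, h.fderiv_eq]

theorem curl_eventuallyEq (b : Fin 3 → E) {V W : E → Fin 3 → 𝕜} {y : E} (h : V =ᶠ[𝓝 y] W) :
    curl b V y = curl b W y := by
  rw [curl, curl, h.fderiv_eq]

theorem fderiv_apply_coord {W : E → Fin 3 → 𝕜} {y : E} (hW : DifferentiableAt 𝕜 W y) (v : E)
    (i : Fin 3) : fderiv 𝕜 (fun z => W z i) y v = fderiv 𝕜 W y v i := by
  rw [(hasFDerivAt_pi'.1 hW.hasFDerivAt i).fderiv]
  rfl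

theorem differentiableAt_grad (b : Fin 3 → E) {f : E → 𝕜} {y : E} (hf : ContDiffAt 𝕜 2 f y) :
    DifferentiableAt 𝕜 (grad b f) y := by
  have : DifferentiableAt 𝕜 (fderiv 𝕜 f) y :=
    (hf.fderiv_right (m := 1) (by norm_num)).differentiableAt (by norm_num)
  exact differentiableAt_pi.2 fun i => this.clm_apply (differentiableAt_const _)

/-- The second derivatives of a function in a frame are symmetric. -/
theorem fderiv_grad_symm (b : Fin 3 → E) {f : E → 𝕜} {y : E} (hf : ContDiffAt 𝕜 2 f y)
    (i j : Fin 3) : fderiv 𝕜 (grad b f) y (b i) j = fderiv 𝕜 (grad b f) y (b j) i := by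
  have hd : DifferentiableAt 𝕜 (fderiv 𝕜 f) y :=
    (hf.fderiv_right (m := 1) (by norm_num)).differentiableAt (by norm_num)
  have key : ∀ i j, fderiv 𝕜 (grad b f) y (b i) j = fderiv 𝕜 (fderiv 𝕜 f) y (b i) (b j) := by
    intro i j
    rw [← fderiv_apply_coord (differentiableAt_grad b hf)]
    change fderiv 𝕜 (fun z => fderiv 𝕜 f z (b j)) y (b i) = _
    rw [fderiv_clm_apply hd (differentiableAt_const _)]
    simp
  rw [key, key]
  exact (hf.isSymmSndFDerivAt (by simp)).eq _ _

theorem curl_grad (b : Fin 3 → E) {f : E → 𝕜} {y : E} (hf : ContDiffAt 𝕜 2 f y) :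
    curl b (grad b f) y = 0 := by
  rw [curl, fderiv_grad_symm b hf 1 2, fderiv_grad_symm b hf 2 0, fderiv_grad_symm b hf 0 1]
  simp

theorem curl_smul (b : Fin 3 → E) {f : E → 𝕜} {W : E → Fin 3 → 𝕜} {y : E}
    (hf : DifferentiableAt 𝕜 f y) (hW : DifferentiableAt 𝕜 W y) :
    curl b (fun z => f z • W z) y = f y • curl b W y + grad b f y ⨯₃ W y := by
  simp only [curl, fderiv_fun_smul hf hW, grad, covectorCoords, cross_apply]
  ext i
  fin_cases i <;> simp <;> ring

theorem curl_add (b : Fin 3 → E) {V W : E → Fin 3 → 𝕜} {y : E}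
    (hV : DifferentiableAt 𝕜 V y) (hW : DifferentiableAt 𝕜 W y) :
    curl b (fun z => V z + W z) y = curl b V y + curl b W y := by
  simp only [curl, fderiv_fun_add hV hW]
  ext i
  fin_cases i <;> simp <;> ring

theorem curl_const (b : Fin 3 → E) (k : Fin 3 → 𝕜) (y : E) : curl b (fun _ => k) y = 0 := by
  simp [curl]

theorem differentiableAt_triple {A B C : E → Fin 3 → 𝕜} {y : E}
    (hA : DifferentiableAt 𝕜 A y) (hB : DifferentiableAt 𝕜 B y) (hC : DifferentiableAt 𝕜 C y) :
    DifferentiableAt 𝕜 (fun z => triple (A z) (B z) (C z)) y := by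
  have hA' := fun i => (differentiableAt_pi.1 hA i)
  have hB' := fun i => (differentiableAt_pi.1 hB i)
  have hC' := fun i => (differentiableAt_pi.1 hC i)
  simp only [triple_apply]
  have := hA' 0; have := hA' 1; have := hA' 2
  have := hB' 0; have := hB' 1; have := hB' 2
  have := hC' 0; have := hC' 1; have := hC' 2
  fun_prop

theorem grad_triple (b : Fin 3 → E) {A B C : E → Fin 3 → 𝕜} {y : E}
    (hA : DifferentiableAt 𝕜 A y) (hB : DifferentiableAt 𝕜 B y) (hC : DifferentiableAt 𝕜 C y)
    (i : Fin 3) :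
    grad b (fun z => triple (A z) (B z) (C z)) y i =
      triple (fderiv 𝕜 A y (b i)) (B y) (C y) + triple (A y) (fderiv 𝕜 B y (b i)) (C y) +
        triple (A y) (B y) (fderiv 𝕜 C y (b i)) := by
  have hA' := fun i => (differentiableAt_pi.1 hA i)
  have hB' := fun i => (differentiableAt_pi.1 hB i)
  have hC' := fun i => (differentiableAt_pi.1 hC i)
  have h := ((((hA' 0).hasFDerivAt.mul (((hB' 1).hasFDerivAt.mul (hC' 2).hasFDerivAt).sub
    ((hB' 2).hasFDerivAt.mul (hC' 1).hasFDerivAt))).add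
    ((hA' 1).hasFDerivAt.mul (((hB' 2).hasFDerivAt.mul (hC' 0).hasFDerivAt).sub
    ((hB' 0).hasFDerivAt.mul (hC' 2).hasFDerivAt)))).add
    ((hA' 2).hasFDerivAt.mul (((hB' 0).hasFDerivAt.mul (hC' 1).hasFDerivAt).sub
    ((hB' 1).hasFDerivAt.mul (hC' 0).hasFDerivAt))))
  have h2 : (fun z => triple (A z) (B z) (C z)) = fun z =>
      A z 0 * (B z 1 * C z 2 - B z 2 * C z 1) + A z 1 * (B z 2 * C z 0 - B z 0 * C z 2) +
      A z 2 * (B z 0 * C z 1 - B z 1 * C z 0) := funext fun z => triple_apply _ _ _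
  rw [grad, covectorCoords, h2]
  erw [h.fderiv]
  simp [fderiv_apply_coord hA, fderiv_apply_coord hB, fderiv_apply_coord hC, triple_apply]
  ring

theorem two_le_infty : (2 : WithTop ℕ∞) ≤ ∞ :=
  WithTop.coe_le_coe.2 (le_top : (2 : ℕ∞) ≤ ⊤)

/-- If `curl W = L ⨯₃ W` around a point then `W` is orthogonal to `curl L` there. -/
theorem dot_curl_eq_zero_of_extDeriv (b : Fin 3 → E) {θ : E → E [⋀^Fin 1]→L[𝕜] 𝕜}
    {L : E → Fin 3 → 𝕜} {y : E} (hθ : ContDiffAt 𝕜 ∞ θ y) (hL : DifferentiableAt 𝕜 L y)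
    (h : ∀ᶠ z in 𝓝 y, curl b (fun z => oneCoords b (θ z)) z = L z ⨯₃ oneCoords b (θ z)) :
    oneCoords b (θ y) ⬝ᵥ curl b L y = 0 := by
  have hθd : ∀ᶠ z in 𝓝 y, DifferentiableAt 𝕜 θ z :=
    (hθ.of_le (m := 1) (by exact_mod_cast le_top) |>.eventually (by simp)).mono
      fun z hz => hz.differentiableAt (by simp)
  have hdd := extDeriv_extDeriv_apply hθ
    (by rw [minSmoothness_of_isRCLikeNormedField]; exact two_le_infty)
  have hd1 : DifferentiableAt 𝕜 (extDeriv θ) y := by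
    have : DifferentiableAt 𝕜 (fderiv 𝕜 θ) y :=
      (hθ.fderiv_right (m := 1) (by norm_num; exact two_le_infty)).differentiableAt (by norm_num)
    exact (ContinuousAlternatingMap.alternatizeUncurryFinCLM 𝕜 E 𝕜).differentiableAt.comp y this
  have hdiv := extDeriv_two_apply_frame b hd1
  set W := fun z => oneCoords b (θ z) with hWdef
  have hW : DifferentiableAt 𝕜 W y := differentiableAt_oneCoords b hθd.self_of_nhds
  have hev : ∀ᶠ z in 𝓝 y, twoCoords b (extDeriv θ z) = L z ⨯₃ W z := by
    filter_upwards [hθd, h] with z hz hz'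
    rw [twoCoords_extDeriv b hz, hz']
  have hc : ∀ i, (fun z => twoCoords b (extDeriv θ z) i) =ᶠ[𝓝 y] fun z => (L z ⨯₃ W z) i :=
    fun i => hev.mono fun z hz => congrFun hz i
  rw [hdd, (hc 0).fderiv_eq, (hc 1).fderiv_eq, (hc 2).fderiv_eq] at hdiv
  have hcur := h.self_of_nhds
  have hL' := fun i => (differentiableAt_pi.1 hL i)
  have hW' := fun i => (differentiableAt_pi.1 hW i)
  have hm : ∀ i j k l : Fin 3, ∀ v, fderiv 𝕜 (fun z => L z i * W z j - L z k * W z l) y v =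
      fderiv 𝕜 L y v i * W y j + L y i * fderiv 𝕜 W y v j -
      (fderiv 𝕜 L y v k * W y l + L y k * fderiv 𝕜 W y v l) := by
    intro i j k l v
    rw [fderiv_fun_sub ((hL' i).fun_mul (hW' j)) ((hL' k).fun_mul (hW' l)),
      fderiv_fun_mul (hL' i) (hW' j),
      fderiv_fun_mul (hL' k) (hW' l)]
    simp [fderiv_apply_coord hL, fderiv_apply_coord hW]
    ring
  simp only [cross_apply, cons_val_zero, cons_val_one, cons_val, hm] at hdiv
  have c0 := congrFun hcur 0
  have c1 := congrFun hcur 1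
  have c2 := congrFun hcur 2
  simp only [cross_apply, curl, cons_val_zero, cons_val_one, cons_val] at c0 c1 c2
  change W y ⬝ᵥ curl b L y = 0
  simp only [vec3_dotProduct, curl, cons_val_zero, cons_val_one, cons_val]
  rw [ContinuousAlternatingMap.coe_zero, Pi.zero_apply] at hdiv
  -- 0 = div (L ⨯ W) = W · curl L - L · curl W, and L · curl W = L · (L ⨯ W) = 0.
  linear_combination -hdiv + L y 0 * c0 + L y 1 * c1 + L y 2 * c2

/-- The three-term Plücker relation for a, b, c, r in the plane modulo w; it removes the derivatives
of the density from the Jacobi identity. -/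
theorem triple_plucker (a b c r w : Fin 3 → 𝕜) :
    triple b c w * triple a r w + triple c a w * triple b r w + triple a b w * triple c r w = 0 := by
  simp only [triple_apply]
  ring

/-- Both terms are the bilinear form A evaluated on b ⨯ w and c ⨯ w, with opposite signs. With A a
Hessian, this removes second derivatives from the Jacobi identity. -/
theorem triple_symm_cancel {A : Fin 3 → Fin 3 → 𝕜} (hA : ∀ i j, A i j = A j i)
    (b c w : Fin 3 → 𝕜) :
    triple b (fun i => triple c (A i) w) w + triple c (fun i => triple (A i) b w) w = 0 := by
  simp only [triple_apply, hA 1 0, hA 2 0, hA 2 1]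
  ring

/-- With D i the i-th derivative of W, these are the terms of the Jacobi identity that differentiate
W. The sum alternates in a, b, c, hence is a multiple of their triple product, and only the
antisymmetric part of D, the curl, survives. -/
theorem triple_cyclic_eq (D : Fin 3 → Fin 3 → 𝕜) (a b c w : Fin 3 → 𝕜) :
    triple a (fun i => triple b c (D i)) w + triple b (fun i => triple c a (D i)) w +
      triple c (fun i => triple a b (D i)) w =
    - (w ⬝ᵥ ![D 1 2 - D 2 1, D 2 0 - D 0 2, D 0 1 - D 1 0]) * triple a b c := by
  simp only [triple_apply, vec3_dotProduct, cons_val_zero, cons_val_one, cons_val]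
  ring

/-- The Jacobi identity for the bracket `ρ⁻¹ (dφ ∧ dψ ∧ W)`, up to the factor measuring the
non-integrability of `W`. -/
theorem jacobi_triple (b : Fin 3 → E) {f g h ρ : E → 𝕜} {W : E → Fin 3 → 𝕜} {y : E}
    (hf : ContDiffAt 𝕜 2 f y) (hg : ContDiffAt 𝕜 2 g y) (hh : ContDiffAt 𝕜 2 h y)
    (hρ : DifferentiableAt 𝕜 ρ y) (hρ0 : ρ y ≠ 0) (hW : DifferentiableAt 𝕜 W y)
    {fg gh hf' : E → 𝕜}
    (hfg : DifferentiableAt 𝕜 fg y) (hgh : DifferentiableAt 𝕜 gh y)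
    (hhf : DifferentiableAt 𝕜 hf' y)
    (efg : ∀ᶠ z in 𝓝 y, triple (grad b f z) (grad b g z) (W z) = fg z * ρ z)
    (egh : ∀ᶠ z in 𝓝 y, triple (grad b g z) (grad b h z) (W z) = gh z * ρ z)
    (ehf : ∀ᶠ z in 𝓝 y, triple (grad b h z) (grad b f z) (W z) = hf' z * ρ z) :
    (triple (grad b f y) (grad b gh y) (W y) + triple (grad b g y) (grad b hf' y) (W y) +
      triple (grad b h y) (grad b fg y) (W y)) * ρ y =
      - (W y ⬝ᵥ curl b W y) * triple (grad b f y) (grad b g y) (grad b h y) := by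
  -- Differentiate χ ρ = triple (dφ, dψ, W) and solve for ρ dχ, so that the inner bracket is never
  -- written as a quotient.
  have prod : ∀ {φ ψ χ : E → 𝕜}, ContDiffAt 𝕜 2 φ y → ContDiffAt 𝕜 2 ψ y →
      DifferentiableAt 𝕜 χ y →
      (∀ᶠ z in 𝓝 y, triple (grad b φ z) (grad b ψ z) (W z) = χ z * ρ z) → ∀ i,
      grad b χ y i * ρ y =
        triple (fderiv 𝕜 (grad b φ) y (b i)) (grad b ψ y) (W y) +
        triple (grad b φ y) (fderiv 𝕜 (grad b ψ) y (b i)) (W y) +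
        triple (grad b φ y) (grad b ψ y) (fderiv 𝕜 W y (b i)) - χ y * grad b ρ y i := by
    intro φ ψ χ hφ hψ hχ e i
    have h1 := congrFun (grad_eventuallyEq b e) i
    rw [grad_triple b (differentiableAt_grad b hφ) (differentiableAt_grad b hψ) hW] at h1
    rw [h1]
    simp only [grad, covectorCoords, fderiv_fun_mul hχ hρ]
    simp
    ring
  have hlin : ∀ u v : Fin 3 → 𝕜, triple u v (W y) * ρ y = triple u (fun i => v i * ρ y) (W y) := by
    intro u v
    simp only [triple_apply]
    ring
  have hadd : ∀ (u v₁ v₂ v₃ r : Fin 3 → 𝕜) (t : 𝕜),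
      triple u (fun i => v₁ i + v₂ i + v₃ i - t * r i) (W y) =
      triple u v₁ (W y) + triple u v₂ (W y) + triple u v₃ (W y) - t * triple u r (W y) := by
    intro u v₁ v₂ v₃ r t
    simp only [triple_apply]
    ring
  have sf := triple_symm_cancel (fderiv_grad_symm b hf) (grad b g y) (grad b h y) (W y)
  have sg := triple_symm_cancel (fderiv_grad_symm b hg) (grad b h y) (grad b f y) (W y)
  have sh := triple_symm_cancel (fderiv_grad_symm b hh) (grad b f y) (grad b g y) (W y)
  have hD := triple_cyclic_eq (fun i => fderiv 𝕜 W y (b i)) (grad b f y) (grad b g y)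
    (grad b h y) (W y)
  -- The contributions of dρ from the three cyclic terms cancel.
  have hP := triple_plucker (grad b f y) (grad b g y) (grad b h y) (grad b ρ y) (W y)
  rw [efg.self_of_nhds, egh.self_of_nhds, ehf.self_of_nhds] at hP
  have hP' : gh y * triple (grad b f y) (grad b ρ y) (W y) +
      hf' y * triple (grad b g y) (grad b ρ y) (W y) +
      fg y * triple (grad b h y) (grad b ρ y) (W y) = 0 := by
    refine mul_left_cancel₀ hρ0 ?_
    linear_combination hP
  rw [curl, ← hD, add_mul, add_mul, hlin, hlin, hlin]
  simp only [prod hg hh hgh egh, prod hh hf hhf ehf, prod hf hg hfg efg, hadd]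
  linear_combination sf + sg + sh - hP'

end VectorCalculus
-- Local primitives: the Poincaré lemma and integration along one coordinate.
section Primitive

variable {𝕜 : Type*} [RCLike 𝕜] {E : Type*} [NormedAddCommGroup E] [NormedSpace 𝕜 E]

/-- The covector with given components in a basis. -/
noncomputable def covectorOfCoords [FiniteDimensional 𝕜 E] (b : Module.Basis (Fin 3) 𝕜 E) :
    (Fin 3 → 𝕜) →L[𝕜] E →L[𝕜] 𝕜 :=
  LinearMap.toContinuousLinearMap
    ((LinearMap.toContinuousLinearMap : (E →ₗ[𝕜] 𝕜) ≃ₗ[𝕜] (E →L[𝕜] 𝕜)).toLinearMap ∘ₗ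
      (b.constr 𝕜 : (Fin 3 → 𝕜) ≃ₗ[𝕜] _).toLinearMap)

theorem covectorOfCoords_apply [FiniteDimensional 𝕜 E] (b : Module.Basis (Fin 3) 𝕜 E)
    (x : Fin 3 → 𝕜) (v : E) : covectorOfCoords b x v = ∑ i, b.repr v i * x i := by
  simp [covectorOfCoords, Module.Basis.constr_apply_fintype]

@[simp]
theorem covectorCoords_covectorOfCoords [FiniteDimensional 𝕜 E] (b : Module.Basis (Fin 3) 𝕜 E)
    (x : Fin 3 → 𝕜) : covectorCoords b (covectorOfCoords b x) = x := by
  ext i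
  simp [covectorCoords, covectorOfCoords]

/-- A curl-free triple of functions on a ball is a gradient. -/
theorem exists_grad_eq_of_curl_eq_zero [FiniteDimensional 𝕜 E] (b : Module.Basis (Fin 3) 𝕜 E)
    {W : E → Fin 3 → 𝕜} {y₀ : E} {r : ℝ} (hW : ContDiffOn 𝕜 ∞ W (Metric.ball y₀ r))
    (h : ∀ y ∈ Metric.ball y₀ r, curl b W y = 0) :
    ∃ f : E → 𝕜, ContDiffOn 𝕜 ∞ f (Metric.ball y₀ r) ∧
      ∀ y ∈ Metric.ball y₀ r, grad b f y = W y := by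
  -- Convexity of the ball refers to a real structure. The symmetry required of the derivative of
  -- the covector field reduces, on basis vectors, to the vanishing of the curl.
  let : NormedSpace ℝ E := NormedSpace.restrictScalars ℝ 𝕜 E
  have : IsScalarTower ℝ 𝕜 E := ⟨fun _ _ _ => by simp⟩
  have hd : ∀ y ∈ Metric.ball y₀ r, DifferentiableAt 𝕜 W y := fun y hy =>
    (hW.contDiffAt (Metric.isOpen_ball.mem_nhds hy)).differentiableAt (by simp)
  have hA : ∀ y ∈ Metric.ball y₀ r, HasFDerivWithinAt (fun y => covectorOfCoords b (W y))
      ((covectorOfCoords b ∘L fderiv 𝕜 W y).restrictScalars ℝ) (Metric.ball y₀ r) y :=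
    fun y hy => (((covectorOfCoords b).hasFDerivAt.comp y
      (hd y hy).hasFDerivAt).restrictScalars ℝ).hasFDerivWithinAt
  obtain ⟨f, hf⟩ := (convex_ball y₀ r).exists_forall_hasFDerivWithinAt_of_hasFDerivWithinAt_symmetric
    hA
    (by
      intro y hy u _ v _
      have hc := h y hy
      have c0 : fderiv 𝕜 W y (b 1) 2 = fderiv 𝕜 W y (b 2) 1 := sub_eq_zero.1 (congrFun hc 0)
      have c1 : fderiv 𝕜 W y (b 2) 0 = fderiv 𝕜 W y (b 0) 2 := sub_eq_zero.1 (congrFun hc 1)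
      have c2 : fderiv 𝕜 W y (b 0) 1 = fderiv 𝕜 W y (b 1) 0 := sub_eq_zero.1 (congrFun hc 2)
      have hu : ∀ u i, fderiv 𝕜 W y u i = ∑ j, b.repr u j * fderiv 𝕜 W y (b j) i := by
        intro u i
        conv_lhs => rw [← b.sum_repr u, map_sum]
        simp only [map_smul, Finset.sum_apply, Pi.smul_apply, smul_eq_mul]
      simp only [ContinuousLinearMap.coe_restrictScalars', ContinuousLinearMap.comp_apply,
        covectorOfCoords_apply, Fin.sum_univ_three, hu u, hu v, c0, c1, c2]
      ring)
  have hf' : ∀ y ∈ Metric.ball y₀ r, HasFDerivAt f (covectorOfCoords b (W y)) y :=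
    fun y hy => (hf y hy).hasFDerivAt (Metric.isOpen_ball.mem_nhds hy)
  refine ⟨f, ?_, fun y hy => ?_⟩
  · rw [contDiffOn_infty_iff_fderiv_of_isOpen Metric.isOpen_ball]
    refine ⟨fun y hy => (hf' y hy).differentiableAt.differentiableWithinAt, ?_⟩
    exact ((covectorOfCoords b).contDiff.comp_contDiffOn hW).congr fun y hy => (hf' y hy).fderiv
  · rw [grad, (hf' y hy).fderiv, covectorCoords_covectorOfCoords]

/-- Averages of a function over the contractions `P + t Q`, `0 ≤ t ≤ 1`, with a weight. -/
noncomputable def weightedMean (P Q : E →L[𝕜] E) (c : ℝ → 𝕜) (h : E → 𝕜) (x : E) : 𝕜 :=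
  ∫ t in (0 : ℝ)..1, c t * h (P x + (t : 𝕜) • Q x)

theorem weightedMean_const_mul (P Q : E →L[𝕜] E) (c : ℝ → 𝕜) (a : 𝕜) (h : E → 𝕜) (x : E) :
    weightedMean P Q c (fun z => a * h z) x = a * weightedMean P Q c h x := by
  simp only [weightedMean, mul_left_comm _ a]
  exact intervalIntegral.integral_const_mul _ _

variable {P Q : E →L[𝕜] E} {U : Set E}

theorem continuousOn_contraction {G : Type*} [TopologicalSpace G]
    (hPQ : ∀ t ∈ Set.Icc (0 : ℝ) 1, ∀ x ∈ U, P x + (t : 𝕜) • Q x ∈ U)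
    {g : E → G} (hg : ContinuousOn g U) :
    ContinuousOn (fun p : E × ℝ => g (P p.1 + (p.2 : 𝕜) • Q p.1)) (U ×ˢ Set.Icc 0 1) := by
  refine hg.comp (Continuous.continuousOn ?_) fun p hp => hPQ p.2 hp.2 p.1 hp.1
  have : Continuous fun p : E × ℝ => (p.2 : 𝕜) := RCLike.continuous_ofReal.comp continuous_snd
  fun_prop

theorem intervalIntegrable_of_prod {G : Type*} [NormedAddCommGroup G] {g : ℝ → E → G} (hg : ContinuousOn (fun p : E × ℝ => g p.2 p.1) (U ×ˢ Set.Icc 0 1))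
    {x : E} (hx : x ∈ U) :
    IntervalIntegrable (fun t => g t x) MeasureTheory.volume 0 1 := by
  apply ContinuousOn.intervalIntegrable
  rw [Set.uIcc_of_le zero_le_one]
  exact hg.comp (f := fun t : ℝ => (x, t)) (by fun_prop) fun t ht => ⟨hx, ht⟩

theorem continuousOn_weightedMean_integrand
    (hPQ : ∀ t ∈ Set.Icc (0 : ℝ) 1, ∀ x ∈ U, P x + (t : 𝕜) • Q x ∈ U) {c : ℝ → 𝕜}
    (hc : Continuous c) {h : E → 𝕜} (hh : ContinuousOn h U) :
    ContinuousOn (fun p : E × ℝ => c p.2 * h (P p.1 + (p.2 : 𝕜) • Q p.1))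
      (U ×ˢ Set.Icc 0 1) :=
  (hc.comp continuous_snd).continuousOn.mul (continuousOn_contraction hPQ hh)

theorem continuousOn_weightedMean_fderiv (hU : IsOpen U)
    (hPQ : ∀ t ∈ Set.Icc (0 : ℝ) 1, ∀ x ∈ U, P x + (t : 𝕜) • Q x ∈ U) {c : ℝ → 𝕜}
    (hc : Continuous c) {h : E → 𝕜} (hh : ContDiffOn 𝕜 ∞ h U) :
    ContinuousOn (fun p : E × ℝ => c p.2 •
      (fderiv 𝕜 h (P p.1 + (p.2 : 𝕜) • Q p.1)).comp (P + (p.2 : 𝕜) • Q))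
      (U ×ˢ Set.Icc 0 1) := by
  have h2 : Continuous fun p : E × ℝ => (p.2 : 𝕜) := RCLike.continuous_ofReal.comp continuous_snd
  refine (hc.comp continuous_snd).continuousOn.smul (ContinuousOn.clm_comp
    (continuousOn_contraction hPQ (hh.continuousOn_fderiv_of_isOpen hU (by simp)))
    (Continuous.continuousOn ?_))
  fun_prop

/-- Differentiation under the integral sign; the derivative of the integrand is bounded by
compactness of a closed ball times the unit interval. -/
theorem hasFDerivAt_weightedMean [FiniteDimensional 𝕜 E] (hU : IsOpen U)
    (hPQ : ∀ t ∈ Set.Icc (0 : ℝ) 1, ∀ x ∈ U, P x + (t : 𝕜) • Q x ∈ U) {c : ℝ → 𝕜}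
    (hc : Continuous c) {h : E → 𝕜} (hh : ContDiffOn 𝕜 ∞ h U) {x : E} (hx : x ∈ U) :
    HasFDerivAt (weightedMean P Q c h)
      (∫ t in (0 : ℝ)..1, c t • (fderiv 𝕜 h (P x + (t : 𝕜) • Q x)).comp (P + (t : 𝕜) • Q)) x := by
  have := FiniteDimensional.proper_rclike 𝕜 E
  obtain ⟨ε, hε, hball⟩ := Metric.nhds_basis_closedBall.mem_iff.1 (hU.mem_nhds hx)
  have hF' := continuousOn_weightedMean_fderiv hU hPQ hc hh
  have hF := continuousOn_weightedMean_integrand hPQ hc hh.continuousOn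
  obtain ⟨C, hC⟩ := ((isCompact_closedBall x ε).prod (isCompact_Icc (a := (0 : ℝ)) (b := 1))
    ).exists_bound_of_continuousOn (hF'.mono (Set.prod_mono hball le_rfl))
  have hI : Set.uIoc (0 : ℝ) 1 ⊆ Set.Icc 0 1 := by
    rw [Set.uIoc_of_le zero_le_one]; exact Set.Ioc_subset_Icc_self
  have hint := fun {z : E} (hz : z ∈ U) => intervalIntegrable_of_prod
    (g := fun t z => c t * h (P z + (t : 𝕜) • Q z)) hF hz
  refine intervalIntegral.hasFDerivAt_integral_of_dominated_of_fderiv_le (𝕜 := 𝕜)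
    (bound := fun _ => C)
    (F' := fun z t => c t • (fderiv 𝕜 h (P z + (t : 𝕜) • Q z)).comp (P + (t : 𝕜) • Q))
    (Metric.closedBall_mem_nhds x hε) ?_ (hint hx) ?_ ?_ ?_ ?_
  · filter_upwards [hU.mem_nhds hx] with z hz
    exact (intervalIntegrable_iff.1 (hint hz)).aestronglyMeasurable
  · exact (intervalIntegrable_iff.1 (intervalIntegrable_of_prod (g := fun t z => c t •
      (fderiv 𝕜 h (P z + (t : 𝕜) • Q z)).comp (P + (t : 𝕜) • Q)) hF' hx)).aestronglyMeasurable
  · exact Filter.Eventually.of_forall fun t ht z hz => hC (z, t) ⟨hz, hI ht⟩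
  · simp
  · refine Filter.Eventually.of_forall fun t ht z hz => ?_
    have h1 : HasFDerivAt h (fderiv 𝕜 h (P z + (t : 𝕜) • Q z)) (P z + (t : 𝕜) • Q z) :=
      ((hh.contDiffAt (hU.mem_nhds (hPQ t (hI ht) z (hball hz)))).differentiableAt
        (by simp)).hasFDerivAt
    have h2 : HasFDerivAt (fun z => P z + (t : 𝕜) • Q z) (P + (t : 𝕜) • Q) z :=
      (P + (t : 𝕜) • Q).hasFDerivAt
    exact (h1.comp z h2).const_mul (c t)

/-- Derivatives of weighted means are again weighted means, with weights c(t) and t c(t). This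
closure is the reason for carrying an arbitrary weight. -/
theorem fderiv_weightedMean_apply [FiniteDimensional 𝕜 E] (hU : IsOpen U)
    (hPQ : ∀ t ∈ Set.Icc (0 : ℝ) 1, ∀ x ∈ U, P x + (t : 𝕜) • Q x ∈ U) {c : ℝ → 𝕜}
    (hc : Continuous c) {h : E → 𝕜} (hh : ContDiffOn 𝕜 ∞ h U) {x : E} (hx : x ∈ U) (v : E) :
    fderiv 𝕜 (weightedMean P Q c h) x v =
      weightedMean P Q c (fun z => fderiv 𝕜 h z (P v)) x +
      weightedMean P Q (fun t => c t * t) (fun z => fderiv 𝕜 h z (Q v)) x := by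
  have hd : ∀ u : E, ContinuousOn (fun z => fderiv 𝕜 h z u) U := fun u =>
    (hh.continuousOn_fderiv_of_isOpen hU (by simp)).clm_apply continuousOn_const
  rw [(hasFDerivAt_weightedMean hU hPQ hc hh hx).fderiv,
    ContinuousLinearMap.intervalIntegral_apply (intervalIntegrable_of_prod
      (g := fun t z => c t • (fderiv 𝕜 h (P z + (t : 𝕜) • Q z)).comp (P + (t : 𝕜) • Q))
      (continuousOn_weightedMean_fderiv hU hPQ hc hh) hx),
    weightedMean, weightedMean, ← intervalIntegral.integral_add
    (intervalIntegrable_of_prod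
      (g := fun t z => c t * fderiv 𝕜 h (P z + (t : 𝕜) • Q z) (P v))
      (continuousOn_weightedMean_integrand hPQ hc (hd _)) hx)
    (intervalIntegrable_of_prod
      (g := fun t z => c t * t * fderiv 𝕜 h (P z + (t : 𝕜) • Q z) (Q v))
      (continuousOn_weightedMean_integrand hPQ (hc.mul RCLike.continuous_ofReal) (hd _)) hx)]
  congr 1
  ext t
  simp
  ring

/-- Induction on the order of differentiability, over all weights and all smooth integrands at once,
since a derivative changes both. -/
theorem contDiffOn_weightedMean [FiniteDimensional 𝕜 E] (hU : IsOpen U)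
    (hPQ : ∀ t ∈ Set.Icc (0 : ℝ) 1, ∀ x ∈ U, P x + (t : 𝕜) • Q x ∈ U) {c : ℝ → 𝕜}
    (hc : Continuous c) {h : E → 𝕜} (hh : ContDiffOn 𝕜 ∞ h U) :
    ContDiffOn 𝕜 ∞ (weightedMean P Q c h) U := by
  have key : ∀ n : ℕ, ∀ {c : ℝ → 𝕜}, Continuous c → ∀ {h : E → 𝕜}, ContDiffOn 𝕜 ∞ h U →
      ContDiffOn 𝕜 n (weightedMean P Q c h) U := by
    intro n
    induction n with
    | zero =>
      intro c hc h hh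
      exact contDiffOn_zero.2 fun x hx =>
        (hasFDerivAt_weightedMean hU hPQ hc hh hx).continuousAt.continuousWithinAt
    | succ n ih =>
      intro c hc h hh
      push_cast
      rw [contDiffOn_succ_iff_fderiv_of_isOpen hU]
      refine ⟨fun x hx => (hasFDerivAt_weightedMean hU hPQ hc hh hx).differentiableAt.differentiableWithinAt,
        by simp, contDiffOn_clm_apply.2 fun v => ?_⟩
      have hd : ∀ u : E, ContDiffOn 𝕜 ∞ (fun z => fderiv 𝕜 h z u) U := fun u =>
        (hh.fderiv_of_isOpen hU (by simp)).clm_apply contDiffOn_const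
      exact ((ih hc (hd _)).add (ih (hc.mul RCLike.continuous_ofReal) (hd _))).congr
        fun x hx => fderiv_weightedMean_apply hU hPQ hc hh hx v
  exact contDiffOn_infty.2 fun n => key n hc hh

/-- The derivative along `Q x` of the averages of `h` recovers `h`. -/
theorem weightedMean_one_add (hU : IsOpen U)
    (hPQ : ∀ t ∈ Set.Icc (0 : ℝ) 1, ∀ x ∈ U, P x + (t : 𝕜) • Q x ∈ U) {h : E → 𝕜}
    (hh : ContDiffOn 𝕜 ∞ h U) {x : E} (hx : x ∈ U) :
    weightedMean P Q (fun _ => 1) h x +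
      weightedMean P Q (fun t => 1 * t) (fun z => fderiv 𝕜 h z (Q x)) x = h (P x + Q x) := by
  have hd : ∀ u : E, ContinuousOn (fun z => fderiv 𝕜 h z u) U := fun u =>
    (hh.continuousOn_fderiv_of_isOpen hU (by simp)).clm_apply continuousOn_const
  have hi₁ := intervalIntegrable_of_prod (g := fun t z => 1 * h (P z + (t : 𝕜) • Q z))
    (continuousOn_weightedMean_integrand hPQ continuous_const hh.continuousOn) hx
  have hi₂ := intervalIntegrable_of_prod
    (g := fun t z => 1 * (t : 𝕜) * fderiv 𝕜 h (P z + (t : 𝕜) • Q z) (Q x))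
    (continuousOn_weightedMean_integrand hPQ (continuous_const.mul RCLike.continuous_ofReal)
      (hd (Q x))) hx
  -- The integrand is the derivative in t of t h(P x + t Q x), which is 0 at t = 0 and h(P x + Q x)
  -- at t = 1.
  rw [weightedMean, weightedMean, ← intervalIntegral.integral_add hi₁ hi₂,
    intervalIntegral.integral_eq_sub_of_hasDerivAt
      (f := fun t : ℝ => (t : 𝕜) * h (P x + (t : 𝕜) • Q x)) _ (hi₁.add hi₂)]
  · simp
  · intro t ht
    rw [Set.uIcc_of_le zero_le_one] at ht
    have h0 : HasDerivAt (fun t : ℝ => (t : 𝕜)) 1 t := by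
      simpa using (RCLike.ofRealCLM (K := 𝕜)).hasDerivAt (x := t)
    have h1 : HasFDerivAt h (fderiv 𝕜 h (P x + (t : 𝕜) • Q x)) (P x + (t : 𝕜) • Q x) :=
      ((hh.contDiffAt (hU.mem_nhds (hPQ t ht x hx))).differentiableAt (by simp)).hasFDerivAt
    have h2 : HasDerivAt (fun a : 𝕜 => P x + a • Q x) (Q x) (t : 𝕜) := by
      simpa using ((hasDerivAt_id (t : 𝕜)).smul_const (Q x)).const_add (P x)
    have h3 : HasDerivAt (fun a : 𝕜 => a * h (P x + a • Q x)) _ (t : 𝕜) :=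
      (hasDerivAt_id (t : 𝕜)).mul (h1.comp_hasDerivAt _ h2)
    have h4 := HasDerivAt.scomp (𝕜 := ℝ) (𝕜' := 𝕜) t h3 h0
    convert! h4 using 1
    simp

/-- A smooth function has, locally, a smooth primitive in a coordinate direction. -/
theorem exists_partial_primitive [FiniteDimensional 𝕜 E] (b : Module.Basis (Fin 3) 𝕜 E)
    {h : E → 𝕜} {V : Set E} (hV : IsOpen V) (hh : ContDiffOn 𝕜 ∞ h V) {s₀ : E} (hs₀ : s₀ ∈ V) :
    ∃ (Z : E → 𝕜) (V' : Set E), IsOpen V' ∧ s₀ ∈ V' ∧ ContDiffOn 𝕜 ∞ Z V' ∧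
      ∀ s ∈ V', fderiv 𝕜 Z s (b 2) = h s := by
  let φ := b.equivFunL
  have hV' : (fun v => s₀ + φ.symm v) ⁻¹' V ∈ 𝓝 (0 : Fin 3 → 𝕜) :=
    (hV.preimage (by fun_prop)).mem_nhds (by simpa using hs₀)
  obtain ⟨ε, hε, hball⟩ := Metric.mem_nhds_iff.1 hV'
  -- A box in the coordinates of `b`: shrinking the last coordinate by a factor in [0, 1] does not
  -- leave it.
  let U : Set E := φ ⁻¹' Metric.ball 0 ε
  have hU : IsOpen U := Metric.isOpen_ball.preimage φ.continuous
  have hUV : ∀ x ∈ U, s₀ + x ∈ V := fun x hx => by simpa using hball hx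
  have h0U : (0 : E) ∈ U := by simpa [U] using hε
  let ℓ : E →L[𝕜] 𝕜 := (ContinuousLinearMap.proj 2).comp (φ : E →L[𝕜] Fin 3 → 𝕜)
  let Q : E →L[𝕜] E := ℓ.smulRight (b 2)
  let P : E →L[𝕜] E := ContinuousLinearMap.id 𝕜 E - Q
  have hPQ : ∀ t ∈ Set.Icc (0 : ℝ) 1, ∀ x ∈ U, P x + (t : 𝕜) • Q x ∈ U := by
    intro t ht x hx
    simp only [U, Set.mem_preimage, mem_ball_zero_iff, pi_norm_lt_iff hε] at hx ⊢
    intro i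
    have hφ : φ (P x + (t : 𝕜) • Q x) i = if i = 2 then (t : 𝕜) * φ x 2 else φ x i := by
      fin_cases i <;> simp [P, Q, ℓ, φ, RCLike.real_smul_eq_coe_mul]
    rw [hφ]
    split_ifs
    · rw [norm_mul, RCLike.norm_ofReal, abs_of_nonneg ht.1]
      exact lt_of_le_of_lt (mul_le_of_le_one_left (norm_nonneg _) ht.2) (hx 2)
    · exact hx i
  have hh' : ContDiffOn 𝕜 ∞ (fun x => h (s₀ + x)) U :=
    hh.comp (by fun_prop) fun x hx => hUV x hx
  have hmean := contDiffOn_weightedMean hU hPQ (c := fun _ => 1) continuous_const hh'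
  -- The integral of h in the last coordinate s from 0 to ℓ x, rescaled by s = t ℓ x to a real
  -- parameter t in [0, 1]. In this form it makes sense over ℂ as well.
  let Z : E → 𝕜 := fun x => ℓ x * weightedMean P Q (fun _ => 1) (fun x => h (s₀ + x)) x
  have hZ : ContDiffOn 𝕜 ∞ Z U := ℓ.contDiff.contDiffOn.mul hmean
  have hb : ℓ (b 2) = 1 := by simp [ℓ, φ]
  have hPb : P (b 2) = 0 := by simp [P, Q, hb]
  have hQb : Q (b 2) = b 2 := by simp [Q, hb]
  have hZd : ∀ x ∈ U, fderiv 𝕜 Z x (b 2) = h (s₀ + x) := by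
    intro x hx
    have hmd : DifferentiableAt 𝕜 (weightedMean P Q (fun _ => 1) (fun x => h (s₀ + x))) x :=
      (hmean.contDiffAt (hU.mem_nhds hx)).differentiableAt (by simp)
    have hone := weightedMean_one_add hU hPQ hh' hx
    have hQx : Q x = ℓ x • b 2 := rfl
    have hPQx : P x + Q x = x := by simp [P]
    rw [hPQx] at hone
    rw [fderiv_fun_mul ℓ.differentiableAt hmd, ← hone]
    simp only [_root_.add_apply, _root_.smul_apply, smul_eq_mul,
      fderiv_weightedMean_apply hU hPQ continuous_const hh' hx, hPb, hQb, hQx,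
      ContinuousLinearMap.fderiv, hb, map_zero, map_smul,
      weightedMean_const_mul]
    simp [weightedMean]
    ring
  refine ⟨fun s => Z (s - s₀), (fun s => s - s₀) ⁻¹' U, hU.preimage (by fun_prop),
    by simpa using h0U, hZ.comp (by fun_prop) fun s hs => hs, fun s hs => ?_⟩
  rw [fderiv_comp_sub, hZd _ hs, add_sub_cancel]

end Primitive
-- Simultaneous normal form of two `1`-forms with a common closed factor.
section NormalForm

variable {𝕜 : Type*} [RCLike 𝕜] {E : Type*} [NormedAddCommGroup E] [NormedSpace 𝕜 E]

/-- The map with components `f`, `g`, `h` in a frame `b`. -/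
def frameMap (b : Fin 3 → E) (f g h : E → 𝕜) (y : E) : E := f y • b 0 + g y • b 1 + h y • b 2

theorem hasFDerivAt_frameMap (b : Fin 3 → E) {f g h : E → 𝕜} {y : E}
    (hf : DifferentiableAt 𝕜 f y) (hg : DifferentiableAt 𝕜 g y) (hh : DifferentiableAt 𝕜 h y) :
    HasFDerivAt (frameMap b f g h) ((fderiv 𝕜 f y).smulRight (b 0) +
      (fderiv 𝕜 g y).smulRight (b 1) + (fderiv 𝕜 h y).smulRight (b 2)) y :=
  ((hf.hasFDerivAt.smul_const (b 0)).add (hg.hasFDerivAt.smul_const (b 1))).add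
    (hh.hasFDerivAt.smul_const (b 2))

theorem covectorCoords_comp_fderiv_frameMap (b : Fin 3 → E) {f g h : E → 𝕜} {y : E}
    (hf : DifferentiableAt 𝕜 f y) (hg : DifferentiableAt 𝕜 g y) (hh : DifferentiableAt 𝕜 h y)
    (α : E →L[𝕜] 𝕜) :
    covectorCoords b (α.comp (fderiv 𝕜 (frameMap b f g h) y)) =
      α (b 0) • grad b f y + α (b 1) • grad b g y + α (b 2) • grad b h y := by
  ext i
  rw [(hasFDerivAt_frameMap b hf hg hh).fderiv]
  simp [covectorCoords, grad]
  ring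

theorem fderiv_apply_eq_dot (b : Module.Basis (Fin 3) 𝕜 E) (f : E → 𝕜) (y v : E) :
    fderiv 𝕜 f y v = grad b f y ⬝ᵥ b.repr v := by
  conv_lhs => rw [← b.sum_repr v, map_sum]
  simp [dotProduct, grad, covectorCoords, mul_comm]

/-- A vector annihilated by the three differentials is zero, by expansion in the reciprocal basis.
So the derivative is injective, hence invertible in finite dimension. -/
theorem exists_equiv_hasFDerivAt_frameMap [FiniteDimensional 𝕜 E] (b : Module.Basis (Fin 3) 𝕜 E)
    {f g h : E → 𝕜} {y : E}
    (hf : DifferentiableAt 𝕜 f y) (hg : DifferentiableAt 𝕜 g y) (hh : DifferentiableAt 𝕜 h y)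
    (h0 : triple (grad b f y) (grad b g y) (grad b h y) ≠ 0) :
    ∃ f' : E ≃L[𝕜] E, HasFDerivAt (frameMap b f g h) (f' : E →L[𝕜] E) y := by
  set D := (fderiv 𝕜 f y).smulRight (b 0) +
      (fderiv 𝕜 g y).smulRight (b 1) + (fderiv 𝕜 h y).smulRight (b 2) with hD
  have hinj : Function.Injective (D : E →ₗ[𝕜] E) := by
    rw [injective_iff_map_eq_zero]
    intro v hv
    have hv' : b.repr (D v) = 0 := by
      have : D v = 0 := hv
      simp [this]
    have c : ∀ i, b.repr (D v) i = 0 := fun i => by rw [hv']; rfl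
    have c0 := c 0
    have c1 := c 1
    have c2 := c 2
    simp [hD, fderiv_apply_eq_dot b] at c0 c1 c2
    have := smul_eq_dot_smul_cross (grad b f y) (grad b g y) (grad b h y) (b.repr v)
    rw [c0, c1, c2] at this
    have h1 : grad b h y ⬝ᵥ grad b f y ⨯₃ grad b g y ≠ 0 := by
      rwa [triple_product_permutation]
    have h2 : (b.repr v : Fin 3 → 𝕜) = 0 := by
      simpa [h1] using this
    exact b.repr.map_eq_zero_iff.1 (DFunLike.coe_injective h2)
  let D' : E ≃L[𝕜] E := (LinearEquiv.ofInjectiveEndo (D : E →ₗ[𝕜] E) hinj).toContinuousLinearEquiv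
  refine ⟨D', ?_⟩
  have : (D' : E →L[𝕜] E) = D := by ext v; rfl
  rw [this]
  exact hasFDerivAt_frameMap b hf hg hh

/-- A smooth map with invertible derivatives on an open set restricts to a diffeomorphism around
each point. -/
theorem exists_openPartialHomeomorph [CompleteSpace E] {F : E → E} {U : Set E} (hU : IsOpen U)
    (hF : ContDiffOn 𝕜 ∞ F U)
    (hF' : ∀ y ∈ U, ∃ f' : E ≃L[𝕜] E, HasFDerivAt F (f' : E →L[𝕜] E) y) {y₀ : E} (hy₀ : y₀ ∈ U) :
    ∃ Φ : OpenPartialHomeomorph E E, y₀ ∈ Φ.source ∧ Φ.source ⊆ U ∧ (Φ : E → E) = F ∧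
      ContDiffOn 𝕜 ∞ Φ.symm Φ.target := by
  obtain ⟨f', hf'⟩ := hF' y₀ hy₀
  have h0 := hF.contDiffAt (hU.mem_nhds hy₀)
  let Ψ := h0.toOpenPartialHomeomorph F hf' (by simp)
  have hΨ : y₀ ∈ Ψ.source := h0.mem_toOpenPartialHomeomorph_source hf' (by simp)
  -- Restricting the source to `U` keeps the derivative invertible at every point of it, so the
  -- inverse is smooth on the whole target.
  refine ⟨Ψ.restrOpen U hU, ⟨hΨ, hy₀⟩, fun y hy => hy.2, rfl, fun a ha => ?_⟩
  have hs := (Ψ.restrOpen U hU).map_target ha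
  obtain ⟨g', hg'⟩ := hF' _ hs.2
  exact ((Ψ.restrOpen U hU).contDiffAt_symm ha hg'
    (hF.contDiffAt (hU.mem_nhds hs.2))).contDiffWithinAt

theorem contDiff_normedSpace_exp : ContDiff 𝕜 ∞ (NormedSpace.exp : 𝕜 → 𝕜) := by
  refine contDiff_iff_contDiffAt.2 fun x => AnalyticAt.contDiffAt ?_
  exact NormedSpace.exp_analytic x

/-- A smooth gradient is the logarithmic derivative of a nowhere vanishing function. -/
theorem exists_integrating_factor (b : Fin 3 → E) {g : E → 𝕜} {U : Set E} (hU : IsOpen U)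
    (hg : ContDiffOn 𝕜 ∞ g U) :
    ∃ u : E → 𝕜, ContDiffOn 𝕜 ∞ u U ∧ (∀ y, u y ≠ 0) ∧
      ∀ y ∈ U, grad b u y = - u y • grad b g y := by
  refine ⟨fun y => NormedSpace.exp (- g y), contDiff_normedSpace_exp.comp_contDiffOn hg.neg,
    fun y => (NormedSpace.isUnit_exp (- g y)).ne_zero, fun y hy => ?_⟩
  have h1 : HasFDerivAt g (fderiv 𝕜 g y) y :=
    ((hg.contDiffAt (hU.mem_nhds hy)).differentiableAt (by simp)).hasFDerivAt
  have h2 := (hasDerivAt_exp (𝕂 := 𝕜) (x := - g y)).comp_hasFDerivAt y h1.neg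
  ext i
  have h3 : fderiv 𝕜 (fun y => NormedSpace.exp (- g y)) y = _ := h2.fderiv
  rw [grad, covectorCoords, h3]
  simp [grad, covectorCoords]

/-- With x, y, z the gradients of new coordinates and a, a' the components of two covectors there,
this shows that coordinates with W and W₁ proportional to x and y make the bi-vectors constant up to
a scalar. -/
theorem triple_linear_combination (a a' : Fin 3 → 𝕜) (x y z : Fin 3 → 𝕜) :
    triple (a 0 • x + a 1 • y + a 2 • z) (a' 0 • x + a' 1 • y + a' 2 • z) x =
        (a 1 * a' 2 - a 2 * a' 1) * triple x y z ∧
      triple (a 0 • x + a 1 • y + a 2 • z) (a' 0 • x + a' 1 • y + a' 2 • z) y =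
        (a 2 * a' 0 - a 0 * a' 2) * triple x y z := by
  constructor <;>
  · simp only [triple_apply, Pi.add_apply, Pi.smul_apply, smul_eq_mul]
    ring

theorem triple_smul_right (a c x : Fin 3 → 𝕜) (t : 𝕜) : triple a c (t • x) = t * triple a c x := by
  simp only [triple_apply, Pi.smul_apply, smul_eq_mul]
  ring

/-- Two `1`-forms with a common closed factor `L` (`dW = L ∧ W`, `dW₁ = L ∧ W₁`) and a volume
density `ρ` have constant components, up to a common scalar, in suitable coordinates. -/
theorem exists_normalForm [FiniteDimensional 𝕜 E] (b : Module.Basis (Fin 3) 𝕜 E)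
    {W W₁ L : E → Fin 3 → 𝕜} {ρ : E → 𝕜} {U : Set E} (hU : IsOpen U)
    (hW : ContDiffOn 𝕜 ∞ W U) (hW₁ : ContDiffOn 𝕜 ∞ W₁ U) (hL : ContDiffOn 𝕜 ∞ L U)
    (hρ : ContDiffOn 𝕜 ∞ ρ U) (hρ0 : ∀ y ∈ U, ρ y ≠ 0)
    (hWL : ∀ y ∈ U, curl b W y = L y ⨯₃ W y) (hW₁L : ∀ y ∈ U, curl b W₁ y = L y ⨯₃ W₁ y)
    (hcL : ∀ y ∈ U, curl b L y = 0) {y₀ : E} (hy₀ : y₀ ∈ U) (hind : W y₀ ⨯₃ W₁ y₀ ≠ 0) :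
    ∃ Φ : OpenPartialHomeomorph E E, y₀ ∈ Φ.source ∧ Φ.source ⊆ U ∧
      ContDiffOn 𝕜 ∞ Φ Φ.source ∧ ContDiffOn 𝕜 ∞ Φ.symm Φ.target ∧
      ∀ y ∈ Φ.source, ∀ α β : E →L[𝕜] 𝕜,
        triple (covectorCoords b (α.comp (fderiv 𝕜 Φ y)))
          (covectorCoords b (β.comp (fderiv 𝕜 Φ y))) (W y) =
            (α (b 1) * β (b 2) - α (b 2) * β (b 1)) * ρ y ∧
        triple (covectorCoords b (α.comp (fderiv 𝕜 Φ y)))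
          (covectorCoords b (β.comp (fderiv 𝕜 Φ y))) (W₁ y) =
            (α (b 2) * β (b 0) - α (b 0) * β (b 2)) * ρ y := by
  have : CompleteSpace E := FiniteDimensional.complete 𝕜 E
  -- A constant covector independent of W and W₁ at `y₀`, hence nearby; it is the differential of a
  -- linear auxiliary coordinate ℓ.
  obtain ⟨k, hk⟩ := exists_ne_zero_of_cross_ne_zero hind
  have hcont : ContinuousOn (fun y => triple (W y) (W₁ y) k) U := by
    have h1 := fun i => (continuousOn_pi.1 hW.continuousOn i)
    have h2 := fun i => (continuousOn_pi.1 hW₁.continuousOn i)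
    simp only [triple_apply]
    have := h1 0; have := h1 1; have := h1 2; have := h2 0; have := h2 1; have := h2 2
    fun_prop
  have hopen : IsOpen (U ∩ (fun y => triple (W y) (W₁ y) k) ⁻¹' {0}ᶜ) :=
    hcont.isOpen_inter_preimage hU isOpen_compl_singleton
  obtain ⟨r, hr, hball⟩ := Metric.isOpen_iff.1 hopen y₀ ⟨hy₀, by
    have : triple (W y₀) (W₁ y₀) k ≠ 0 := by
      rwa [triple, ← triple_product_permutation]
    exact this⟩
  set B := Metric.ball y₀ r with hB
  have hBo : IsOpen B := Metric.isOpen_ball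
  have hyB : y₀ ∈ B := Metric.mem_ball_self hr
  have hBU : B ⊆ U := fun y hy => (hball hy).1
  have hBk : ∀ y ∈ B, triple (W y) (W₁ y) k ≠ 0 := fun y hy => (hball hy).2
  obtain ⟨g, hg, hgL⟩ := exists_grad_eq_of_curl_eq_zero b (hL.mono hBU) fun y hy => hcL y (hBU hy)
  obtain ⟨u, hu, hu0, hgu⟩ := exists_integrating_factor b hBo hg
  -- Since du = -u dg and L = dg, d(uV) = u (L ∧ V) + du ∧ V = 0.
  have hclosed : ∀ {V : E → Fin 3 → 𝕜}, ContDiffOn 𝕜 ∞ V U →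
      (∀ y ∈ U, curl b V y = L y ⨯₃ V y) → ∀ y ∈ B, curl b (fun z => u z • V z) y = 0 := by
    intro V hV hVL y hy
    rw [curl_smul b ((hu.contDiffAt (hBo.mem_nhds hy)).differentiableAt (by simp))
      ((hV.contDiffAt (hU.mem_nhds (hBU hy))).differentiableAt (by simp)),
      hVL y (hBU hy), hgu y hy, hgL y hy]
    simp
  obtain ⟨x, hx, hxW⟩ := exists_grad_eq_of_curl_eq_zero b (W := fun z => u z • W z)
    (hu.smul (hW.mono hBU)) (hclosed hW hWL)
  obtain ⟨x₁, hx₁, hx₁W⟩ := exists_grad_eq_of_curl_eq_zero b (W := fun z => u z • W₁ z)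
    (hu.smul (hW₁.mono hBU)) (hclosed hW₁ hW₁L)
  set ℓ := covectorOfCoords b k with hℓ
  have hgℓ : ∀ y, grad b ℓ y = k := fun y => by
    rw [grad, ContinuousLinearMap.fderiv, hℓ, covectorCoords_covectorOfCoords]
  have hxd : ∀ y ∈ B, DifferentiableAt 𝕜 x y := fun y hy =>
    (hx.contDiffAt (hBo.mem_nhds hy)).differentiableAt (by simp)
  have hx₁d : ∀ y ∈ B, DifferentiableAt 𝕜 x₁ y := fun y hy =>
    (hx₁.contDiffAt (hBo.mem_nhds hy)).differentiableAt (by simp)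
  have hT : ∀ y ∈ B, triple (grad b x y) (grad b x₁ y) k = u y ^ 2 * triple (W y) (W₁ y) k := by
    intro y hy
    rw [hxW y hy, hx₁W y hy]
    simp only [triple_apply, Pi.smul_apply, smul_eq_mul]
    ring
  have hT0 : ∀ y ∈ B, u y ^ 2 * triple (W y) (W₁ y) k ≠ 0 := fun y hy =>
    mul_ne_zero (pow_ne_zero _ (hu0 y)) (hBk y hy)
  have hframe : ∀ {z : E → 𝕜} {s : Set E}, s ⊆ B → ContDiffOn 𝕜 ∞ z s →
      ContDiffOn 𝕜 ∞ (frameMap b x x₁ z) s := fun hs hz =>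
    (((hx.mono hs).smul contDiffOn_const).add ((hx₁.mono hs).smul contDiffOn_const)).add
      (hz.smul contDiffOn_const)
  -- Auxiliary coordinates (x, x₁, ℓ), used only to integrate along the ℓ-direction.
  obtain ⟨Ψ, hyΨ, hΨB, hΨ, hΨs⟩ := exists_openPartialHomeomorph hBo
    (hframe le_rfl ℓ.contDiff.contDiffOn) (fun y hy => exists_equiv_hasFDerivAt_frameMap b
      (hxd y hy) (hx₁d y hy) ℓ.differentiableAt (by rw [hgℓ, hT y hy]; exact hT0 y hy)) hyB
  -- The value prescribed for ∂z/∂ℓ: it is ρu divided by the triple product of dx, dx₁, dℓ, so that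
  -- dx, dx₁, dz have triple product ρu.
  have hH : ContDiffOn 𝕜 ∞ (fun y => ρ y * u y / (u y ^ 2 * triple (W y) (W₁ y) k)) B := by
    have h1 := fun i => contDiffOn_pi.1 (hW.mono hBU) i
    have h2 := fun i => contDiffOn_pi.1 (hW₁.mono hBU) i
    have h3 : ContDiffOn 𝕜 ∞ (fun y => triple (W y) (W₁ y) k) B := by
      simp only [triple_apply]
      have := h1 0; have := h1 1; have := h1 2; have := h2 0; have := h2 1; have := h2 2
      fun_prop
    exact ((hρ.mono hBU).mul hu).div ((hu.pow 2).mul h3) hT0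
  obtain ⟨Z, V, hV, hyV, hZ, hZd⟩ := exists_partial_primitive b Ψ.open_target
    (hH.comp hΨs fun s hs => hΨB (Ψ.map_target hs)) (Ψ.map_source hyΨ)
  set z : E → 𝕜 := fun y => Z (frameMap b x x₁ ℓ y) with hz
  have hS : IsOpen (Ψ.source ∩ Ψ ⁻¹' V) := Ψ.isOpen_inter_preimage hV
  have hSB : Ψ.source ∩ Ψ ⁻¹' V ⊆ B := fun y hy => hΨB hy.1
  have hΨV : ∀ y ∈ Ψ.source ∩ Ψ ⁻¹' V, frameMap b x x₁ ℓ y ∈ V := fun y hy => by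
    rw [← hΨ]; exact hy.2
  have hzS : ContDiffOn 𝕜 ∞ z (Ψ.source ∩ Ψ ⁻¹' V) :=
    hZ.comp ((hframe le_rfl ℓ.contDiff.contDiffOn).mono hSB) hΨV
  -- The coefficients of dx and dx₁ in dz are left undetermined, because they drop out of the triple
  -- product with dx and dx₁.
  have hgz : ∀ y ∈ Ψ.source ∩ Ψ ⁻¹' V, ∃ c c₁ : 𝕜, grad b z y = c • grad b x y +
      c₁ • grad b x₁ y + (ρ y * u y / (u y ^ 2 * triple (W y) (W₁ y) k)) • k := by
    intro y hy
    have hyB' := hSB hy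
    have hZ' : HasFDerivAt Z (fderiv 𝕜 Z (frameMap b x x₁ ℓ y)) (frameMap b x x₁ ℓ y) :=
      ((hZ.contDiffAt (hV.mem_nhds (hΨV y hy))).differentiableAt (by simp)).hasFDerivAt
    have hcomp := hZ'.comp y (hasFDerivAt_frameMap b (hxd y hyB') (hx₁d y hyB')
      ℓ.differentiableAt).differentiableAt.hasFDerivAt
    have hb2 : fderiv 𝕜 Z (frameMap b x x₁ ℓ y) (b 2) =
        ρ y * u y / (u y ^ 2 * triple (W y) (W₁ y) k) := by
      rw [hZd _ (hΨV y hy)]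
      have : Ψ.symm (frameMap b x x₁ ℓ y) = y := by rw [← hΨ]; exact Ψ.left_inv hy.1
      simp only [Function.comp_apply, this]
    refine ⟨fderiv 𝕜 Z (frameMap b x x₁ ℓ y) (b 0), fderiv 𝕜 Z (frameMap b x x₁ ℓ y) (b 1), ?_⟩
    have h1 : fderiv 𝕜 z y = _ := hcomp.fderiv
    rw [grad, h1, covectorCoords_comp_fderiv_frameMap b (hxd y hyB') (hx₁d y hyB')
      ℓ.differentiableAt, hgℓ, hb2]
  have hTz : ∀ y ∈ Ψ.source ∩ Ψ ⁻¹' V,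
      triple (grad b x y) (grad b x₁ y) (grad b z y) = ρ y * u y := by
    intro y hy
    obtain ⟨c, c₁, h⟩ := hgz y hy
    have h1 : triple (grad b x y) (grad b x₁ y) (grad b z y) =
        (ρ y * u y / (u y ^ 2 * triple (W y) (W₁ y) k)) *
          triple (grad b x y) (grad b x₁ y) k := by
      rw [h]
      simp only [triple_apply, Pi.add_apply, Pi.smul_apply, smul_eq_mul]
      ring
    rw [h1, hT y (hSB hy), div_mul_cancel₀ _ (hT0 y (hSB hy))]
  have hzd : ∀ y ∈ Ψ.source ∩ Ψ ⁻¹' V, DifferentiableAt 𝕜 z y := fun y hy =>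
    (hzS.contDiffAt (hS.mem_nhds hy)).differentiableAt (by simp)
  obtain ⟨Φ, hyΦ, hΦS, hΦ, hΦs⟩ := exists_openPartialHomeomorph hS (hframe hSB hzS)
    (fun y hy => exists_equiv_hasFDerivAt_frameMap b (hxd y (hSB hy)) (hx₁d y (hSB hy))
      (hzd y hy) (by rw [hTz y hy]; exact mul_ne_zero (hρ0 y (hBU (hSB hy))) (hu0 y)))
    (y₀ := y₀) ⟨hyΨ, hyV⟩
  refine ⟨Φ, hyΦ, fun y hy => hBU (hSB (hΦS hy)), ?_, hΦs, fun y hy α β => ?_⟩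
  · rw [hΦ]; exact (hframe hSB hzS).mono hΦS
  · have hyS := hΦS hy
    have hyB' := hSB hyS
    rw [hΦ, covectorCoords_comp_fderiv_frameMap b (hxd y hyB') (hx₁d y hyB') (hzd y hyS),
      covectorCoords_comp_fderiv_frameMap b (hxd y hyB') (hx₁d y hyB') (hzd y hyS)]
    obtain ⟨h1, h2⟩ := triple_linear_combination (covectorCoords b α) (covectorCoords b β)
      (grad b x y) (grad b x₁ y) (grad b z y)
    constructor
    -- As uW = dx, multiplication by u turns the left side into a triple product of coordinate
    -- differentials, equal to a constant-coefficient expression times ρu; the factor u cancels.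
    · refine mul_left_cancel₀ (hu0 y) ?_
      rw [← triple_smul_right, ← hxW y hyB']
      refine h1.trans ?_
      rw [hTz y hyS]
      simp only [covectorCoords]
      ring
    · refine mul_left_cancel₀ (hu0 y) ?_
      rw [← triple_smul_right, ← hx₁W y hyB']
      refine h2.trans ?_
      rw [hTz y hyS]
      simp only [covectorCoords]
      ring

end NormalForm
-- Forms and bi-vectors in charts of the maximal atlas.
theorem isOpen_transition_source {X Y Z : Type*} [TopologicalSpace X] [TopologicalSpace Y]
    [TopologicalSpace Z] (e : OpenPartialHomeomorph X Y) (e' : OpenPartialHomeomorph X Z) :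
    IsOpen (e.target ∩ e.symm ⁻¹' e'.source) :=
  e.symm.isOpen_inter_preimage e'.open_source

section Charts

variable {𝕜 : Type*} [RCLike 𝕜] {E : Type*} [NormedAddCommGroup E] [NormedSpace 𝕜 E]
  {M : Type*} [TopologicalSpace M] [ChartedSpace E M]

/-- The values of a form, on the model space that underlies all tangent spaces. -/
def DiffForm.toModel {k : ℕ} (η : DiffForm 𝕜 E M k) (p : M) : E [⋀^Fin k]→L[𝕜] 𝕜 := η p

/-- The values of a bi-vector field, on the model space that underlies all tangent spaces. -/
def BivectorField.toModel (Λ : BivectorField 𝕜 E M) (p : M) : (E →L[𝕜] 𝕜) [⋀^Fin 2]→L[𝕜] 𝕜 := Λ p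

/-- The derivative of a chart, between model spaces. -/
noncomputable def chartDeriv (e : OpenPartialHomeomorph M E) (p : M) : E →L[𝕜] E :=
  mfderiv 𝓘(𝕜, E) 𝓘(𝕜, E) e p

/-- The derivative of the inverse of a chart, between model spaces. -/
noncomputable def chartDerivSymm (e : OpenPartialHomeomorph M E) (y : E) : E →L[𝕜] E :=
  mfderiv 𝓘(𝕜, E) 𝓘(𝕜, E) e.symm y

theorem DiffForm.inChart_eq {k : ℕ} (η : DiffForm 𝕜 E M k) (e : OpenPartialHomeomorph M E) (y : E) :
    η.inChart e y = (η.toModel (e.symm y)).compContinuousLinearMap (chartDerivSymm e y) := rfl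

theorem BivectorField.inChart_apply (Λ : BivectorField 𝕜 E M) (e : OpenPartialHomeomorph M E)
    (y : E) (α β : E →L[𝕜] 𝕜) :
    Λ.inChart e y ![α, β] = Λ.toModel (e.symm y) ![α.comp (chartDeriv e (e.symm y)),
      β.comp (chartDeriv e (e.symm y))] := by
  rw [BivectorField.inChart, ContinuousAlternatingMap.compContinuousLinearMap_apply]
  change Λ.toModel (e.symm y) _ = _
  congr 1
  ext i
  fin_cases i <;> rfl

theorem extMul_compContinuousLinearMap {k : ℕ} (α : E →L[𝕜] 𝕜) (η : E [⋀^Fin k]→L[𝕜] 𝕜)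
    (A : E →L[𝕜] E) :
    (extMul α η).compContinuousLinearMap A =
      extMul (α.comp A) (η.compContinuousLinearMap A) := by
  ext v
  simp only [extMul, ContinuousAlternatingMap.compContinuousLinearMap_apply,
    ContinuousAlternatingMap.alternatizeUncurryFin_apply]
  rfl

/-- A `1`-form on a normed space as a covector. -/
noncomputable def toCovector (η : E [⋀^Fin 1]→L[𝕜] 𝕜) : E →L[𝕜] 𝕜 :=
  (ContinuousAlternatingMap.ofSubsingleton 𝕜 E 𝕜 (0 : Fin 1)).symm η

theorem toCovector_apply (η : E [⋀^Fin 1]→L[𝕜] 𝕜) (v : E) : toCovector η v = η ![v] := by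
  have : η = ContinuousAlternatingMap.ofSubsingleton 𝕜 E 𝕜 (0 : Fin 1) (toCovector η) := by
    simp [toCovector]
  conv_rhs => rw [this]
  rfl

theorem toCovector_compContinuousLinearMap (η : E [⋀^Fin 1]→L[𝕜] 𝕜) (A : E →L[𝕜] E) :
    (toCovector η).comp A = toCovector (η.compContinuousLinearMap A) := by
  ext v
  rw [ContinuousLinearMap.comp_apply, toCovector_apply, toCovector_apply,
    ContinuousAlternatingMap.compContinuousLinearMap_apply]
  congr 1
  ext i
  fin_cases i
  rfl

theorem covectorCoords_toCovector (b : Fin 3 → E) (η : E [⋀^Fin 1]→L[𝕜] 𝕜) :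
    covectorCoords b (toCovector η) = oneCoords b η :=
  funext fun _ => toCovector_apply _ _

variable {e e' : OpenPartialHomeomorph M E}

theorem mdifferentiable_of_mem_maximalAtlas
    (he : e ∈ IsManifold.maximalAtlas 𝓘(𝕜, E) ∞ M) :
    e.MDifferentiable 𝓘(𝕜, E) 𝓘(𝕜, E) :=
  ⟨(contMDiffOn_of_mem_maximalAtlas he).mdifferentiableOn (by simp),
    (contMDiffOn_symm_of_mem_maximalAtlas he).mdifferentiableOn (by simp)⟩

theorem contDiffOn_transition (he : e ∈ IsManifold.maximalAtlas 𝓘(𝕜, E) ∞ M)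
    (he' : e' ∈ IsManifold.maximalAtlas 𝓘(𝕜, E) ∞ M) :
    ContDiffOn 𝕜 ∞ (e' ∘ e.symm) (e.target ∩ e.symm ⁻¹' e'.source) := by
  rw [← contMDiffOn_iff_contDiffOn]
  exact (contMDiffOn_of_mem_maximalAtlas he').comp
    ((contMDiffOn_symm_of_mem_maximalAtlas he).mono Set.inter_subset_left) fun y hy => hy.2

theorem chartDeriv_comp_chartDerivSymm (he : e ∈ IsManifold.maximalAtlas 𝓘(𝕜, E) ∞ M) {y : E}
    (hy : y ∈ e.target) :
    (chartDeriv (𝕜 := 𝕜) e (e.symm y)).comp (chartDerivSymm e y) = ContinuousLinearMap.id 𝕜 E :=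
  (mdifferentiable_of_mem_maximalAtlas he).comp_symm_deriv hy

theorem chartDerivSymm_comp_chartDeriv (he : e ∈ IsManifold.maximalAtlas 𝓘(𝕜, E) ∞ M) {p : M}
    (hp : p ∈ e.source) :
    (chartDerivSymm (𝕜 := 𝕜) e (e p)).comp (chartDeriv e p) = ContinuousLinearMap.id 𝕜 E :=
  (mdifferentiable_of_mem_maximalAtlas he).symm_comp_deriv hp

theorem chartDerivSymm_comp_chartDeriv' (he : e ∈ IsManifold.maximalAtlas 𝓘(𝕜, E) ∞ M) {y : E}
    (hy : y ∈ e.target) :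
    (chartDerivSymm (𝕜 := 𝕜) e y).comp (chartDeriv e (e.symm y)) = ContinuousLinearMap.id 𝕜 E := by
  have := chartDerivSymm_comp_chartDeriv (𝕜 := 𝕜) he (e.map_target hy)
  rwa [e.right_inv hy] at this

theorem fderiv_transition (he : e ∈ IsManifold.maximalAtlas 𝓘(𝕜, E) ∞ M)
    (he' : e' ∈ IsManifold.maximalAtlas 𝓘(𝕜, E) ∞ M) {y : E} (hy : y ∈ e.target)
    (hy' : e.symm y ∈ e'.source) :
    fderiv 𝕜 (e' ∘ e.symm) y =
      (chartDeriv (𝕜 := 𝕜) e' (e.symm y)).comp (chartDerivSymm e y) := by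
  rw [← mfderiv_eq_fderiv]
  exact mfderiv_comp y ((mdifferentiable_of_mem_maximalAtlas he').mdifferentiableAt hy')
    ((mdifferentiable_of_mem_maximalAtlas he).mdifferentiableAt_symm hy)

theorem chartDerivSymm_eq_comp (he : e ∈ IsManifold.maximalAtlas 𝓘(𝕜, E) ∞ M)
    (he' : e' ∈ IsManifold.maximalAtlas 𝓘(𝕜, E) ∞ M) {y : E} (hy : y ∈ e.target)
    (hy' : e.symm y ∈ e'.source) :
    chartDerivSymm (𝕜 := 𝕜) e y =
      (chartDerivSymm e' (e' (e.symm y))).comp (fderiv 𝕜 (e' ∘ e.symm) y) := by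
  rw [fderiv_transition he he' hy hy', ← ContinuousLinearMap.comp_assoc, chartDerivSymm_comp_chartDeriv he' hy']
  rfl

theorem DiffForm.inChart_eq_pullback {k : ℕ} (η : DiffForm 𝕜 E M k)
    (he : e ∈ IsManifold.maximalAtlas 𝓘(𝕜, E) ∞ M)
    (he' : e' ∈ IsManifold.maximalAtlas 𝓘(𝕜, E) ∞ M) {y : E} (hy : y ∈ e.target)
    (hy' : e.symm y ∈ e'.source) :
    η.inChart e y = (η.inChart e' ((e' ∘ e.symm) y)).compContinuousLinearMap
      (fderiv 𝕜 (e' ∘ e.symm) y) := by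
  rw [DiffForm.inChart_eq, DiffForm.inChart_eq, chartDerivSymm_eq_comp he he' hy hy']
  rw [Function.comp_apply, e'.left_inv hy']
  rfl

/-- Forms are determined by their expressions in a chart. -/
theorem DiffForm.toModel_eq (he : e ∈ IsManifold.maximalAtlas 𝓘(𝕜, E) ∞ M) {k : ℕ}
    (η : DiffForm 𝕜 E M k) {p : M} (hp : p ∈ e.source) :
    η.toModel p = (η.inChart e (e p)).compContinuousLinearMap (chartDeriv e p) := by
  rw [DiffForm.inChart_eq, e.left_inv hp]
  have := chartDerivSymm_comp_chartDeriv (𝕜 := 𝕜) he hp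
  ext v
  simp only [ContinuousAlternatingMap.compContinuousLinearMap_apply]
  congr 1
  ext i
  exact (congrArg (fun f : E →L[𝕜] E => f (v i)) this).symm

theorem DiffForm.inChart_eventuallyEq_pullback {k : ℕ} (η : DiffForm 𝕜 E M k)
    (he : e ∈ IsManifold.maximalAtlas 𝓘(𝕜, E) ∞ M)
    (he' : e' ∈ IsManifold.maximalAtlas 𝓘(𝕜, E) ∞ M) {y : E} (hy : y ∈ e.target)
    (hy' : e.symm y ∈ e'.source) :
    η.inChart e =ᶠ[𝓝 y] fun z => (η.inChart e' ((e' ∘ e.symm) z)).compContinuousLinearMap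
      (fderiv 𝕜 (e' ∘ e.symm) z) := by
  filter_upwards [(isOpen_transition_source e e').mem_nhds ⟨hy, hy'⟩] with z hz
  exact η.inChart_eq_pullback he he' hz.1 hz.2

theorem DiffForm.IsSmooth.differentiableAt_of_mem_atlas {k : ℕ} {η : DiffForm 𝕜 E M k}
    (hη : η.IsSmooth) (he : e ∈ atlas E M) {y : E} (hy : y ∈ e.target) :
    DifferentiableAt 𝕜 (η.inChart e) y :=
  ((hη e he).contDiffAt (e.open_target.mem_nhds hy)).differentiableAt (by simp)

theorem contDiffAt_transition (he : e ∈ IsManifold.maximalAtlas 𝓘(𝕜, E) ∞ M)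
    (he' : e' ∈ IsManifold.maximalAtlas 𝓘(𝕜, E) ∞ M) {y : E} (hy : y ∈ e.target)
    (hy' : e.symm y ∈ e'.source) : ContDiffAt 𝕜 ∞ (e' ∘ e.symm) y :=
  (contDiffOn_transition he he').contDiffAt ((isOpen_transition_source e e').mem_nhds ⟨hy, hy'⟩)

variable [IsManifold 𝓘(𝕜, E) ∞ M]

theorem DiffForm.IsSmooth.differentiableAt_inChart {k : ℕ} {η : DiffForm 𝕜 E M k}
    (hη : η.IsSmooth)
    (he : e ∈ IsManifold.maximalAtlas 𝓘(𝕜, E) ∞ M) {y : E} (hy : y ∈ e.target) :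
    DifferentiableAt 𝕜 (η.inChart e) y := by
  have he' := IsManifold.chart_mem_maximalAtlas (I := 𝓘(𝕜, E)) (n := ∞) (e.symm y)
  have hy' := mem_chart_source E (e.symm y)
  have hτ := contDiffAt_transition he he' hy hy'
  rw [(η.inChart_eventuallyEq_pullback he he' hy hy').differentiableAt_iff]
  refine DifferentiableAt.continuousAlternatingMapCompContinuousLinearMap ?_ ?_
  · exact DifferentiableAt.comp y (hη.differentiableAt_of_mem_atlas (chart_mem_atlas E _)
      ((chartAt E (e.symm y)).map_source hy')) (hτ.differentiableAt (by simp))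
  · exact (hτ.fderiv_right (m := 1) (by norm_num; exact two_le_infty)).differentiableAt (by simp)

/-- `DiffForm.d` uses the preferred chart at each point; the formula holds in every chart because
`extDeriv` commutes with pullback by transition maps. -/
theorem DiffForm.IsSmooth.inChart_d {k : ℕ} {η : DiffForm 𝕜 E M k} (hη : η.IsSmooth)
    (he : e ∈ IsManifold.maximalAtlas 𝓘(𝕜, E) ∞ M) {y : E} (hy : y ∈ e.target) :
    η.d.inChart e y = extDeriv (η.inChart e) y := by
  have he' := IsManifold.chart_mem_maximalAtlas (I := 𝓘(𝕜, E)) (n := ∞) (e.symm y)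
  have hy' := mem_chart_source E (e.symm y)
  rw [(η.inChart_eventuallyEq_pullback he he' hy hy').extDeriv_eq,
    extDeriv_pullback (f := chartAt E (e.symm y) ∘ e.symm) (hη.differentiableAt_of_mem_atlas (chart_mem_atlas E _)
      ((chartAt E (e.symm y)).map_source hy')) (contDiffAt_transition he he' hy hy')
      (by rw [minSmoothness_of_isRCLikeNormedField]; exact two_le_infty),
    fderiv_transition he he' hy hy']
  rfl

/-- The value of an alternating form in terms of its components in a basis. -/
theorem apply_eq_sum_repr {k : ℕ} (b : Module.Basis (Fin 3) 𝕜 E) (η : E [⋀^Fin k]→L[𝕜] 𝕜)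
    (v : Fin k → E) :
    η v = ∑ r : Fin k → Fin 3, (∏ i, b.repr (v i) (r i)) * η fun i => b (r i) := by
  have hv : v = fun i => ∑ j, b.repr (v i) j • b j := funext fun i => (b.sum_repr (v i)).symm
  have h : η v = η fun i => ∑ j, b.repr (v i) j • b j := congrArg η hv
  rw [h, η.map_sum]
  refine Finset.sum_congr rfl fun r _ => ?_
  rw [η.map_smul_univ]
  rfl

/-- `IsSmooth` tests only the charts of the atlas, while flat coordinates lie in the maximal one.
Expansion in a basis gives a polynomial in the derivatives of the transition map and the components
in the preferred chart. -/
theorem DiffForm.IsSmooth.contDiffOn_inChart_apply [FiniteDimensional 𝕜 E] {k : ℕ}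
    {η : DiffForm 𝕜 E M k} (hη : η.IsSmooth) (b : Module.Basis (Fin 3) 𝕜 E)
    (he : e ∈ IsManifold.maximalAtlas 𝓘(𝕜, E) ∞ M) (v : Fin k → E) :
    ContDiffOn 𝕜 ∞ (fun y => η.inChart e y v) e.target := by
  intro y hy
  have he' := IsManifold.chart_mem_maximalAtlas (I := 𝓘(𝕜, E)) (n := ∞) (e.symm y)
  have hy' := mem_chart_source E (e.symm y)
  set e' := chartAt E (e.symm y) with he'def
  have hτ := contDiffOn_transition he he'
  refine ContDiffAt.contDiffWithinAt ?_
  refine ContDiffOn.contDiffAt (s := e.target ∩ e.symm ⁻¹' e'.source) ?_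
    ((isOpen_transition_source e e').mem_nhds ⟨hy, hy'⟩)
  have hexp : ∀ z ∈ e.target ∩ e.symm ⁻¹' e'.source, η.inChart e z v =
      ∑ r : Fin k → Fin 3, (∏ i, b.equivFunL (fderiv 𝕜 (e' ∘ e.symm) z (v i)) (r i)) *
        η.inChart e' ((e' ∘ e.symm) z) fun i => b (r i) := by
    intro z hz
    rw [η.inChart_eq_pullback he he' hz.1 hz.2,
      ContinuousAlternatingMap.compContinuousLinearMap_apply, apply_eq_sum_repr b]
    rfl
  refine ContDiffOn.congr ?_ hexp
  refine ContDiffOn.sum fun r _ => ContDiffOn.mul (contDiffOn_prod fun i _ => ?_) ?_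
  · have h1 : ContDiffOn 𝕜 ∞ (fun z => fderiv 𝕜 (e' ∘ e.symm) z (v i))
        (e.target ∩ e.symm ⁻¹' e'.source) :=
      (hτ.fderiv_of_isOpen (isOpen_transition_source e e') (by simp)).clm_apply contDiffOn_const
    exact contDiffOn_pi.1 (b.equivFunL.contDiff.comp_contDiffOn h1) (r i)
  · have h2 := (hη e' (chart_mem_atlas E _)).comp hτ fun z hz => e'.map_source hz.2
    exact (ContinuousAlternatingMap.apply 𝕜 E 𝕜 fun i => b (r i)).contDiff.comp_contDiffOn h2

end Charts
-- Representing forms in components, and genericity as linear independence.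
theorem mul_eq_mul_of_cross_eq_zero {K : Type*} [Field K] {a c : Fin 3 → K} (h : a ⨯₃ c = 0)
    (i j : Fin 3) : a i * c j = a j * c i := by
  have h0 := congrFun h 0
  have h1 := congrFun h 1
  have h2 := congrFun h 2
  simp only [cross_apply, cons_val_zero, cons_val_one, cons_val, Pi.zero_apply] at h0 h1 h2
  fin_cases i <;> fin_cases j <;> simp only [Fin.mk_one, Fin.zero_eta, Fin.reduceFinMk] <;>
    first
    | linear_combination h0
    | linear_combination -h0
    | linear_combination h1
    | linear_combination -h1
    | linear_combination h2
    | linear_combination -h2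

section Representation

variable {𝕜 : Type*} [RCLike 𝕜] {E : Type*} [NormedAddCommGroup E] [NormedSpace 𝕜 E]
  {M : Type*} [TopologicalSpace M] [ChartedSpace E M]

/-- The components of a `1`-form in a chart. -/
noncomputable def DiffForm.components (b : Fin 3 → E) (η : DiffForm 𝕜 E M 1)
    (e : OpenPartialHomeomorph M E) (y : E) : Fin 3 → 𝕜 :=
  oneCoords b (η.inChart e y)

/-- The density of a `3`-form in a chart. -/
noncomputable def DiffForm.density (b : Fin 3 → E) (η : DiffForm 𝕜 E M 3)
    (e : OpenPartialHomeomorph M E) (y : E) : 𝕜 :=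
  η.inChart e y b

variable {e : OpenPartialHomeomorph M E} {w w₁ lam : DiffForm 𝕜 E M 1} {Ω : DiffForm 𝕜 E M 3}
  {Λ Λ₁ : BivectorField 𝕜 E M}

theorem Represents.toModel (hrep : Represents w Ω Λ) (p : M) (α β : E →L[𝕜] 𝕜) :
    extMul α (extMul β (w.toModel p)) = Λ.toModel p ![α, β] • Ω.toModel p :=
  hrep p α β

theorem IsGeneric.toModel (hgen : IsGeneric Λ Λ₁) (p : M) {s t : ℂ} (hst : (s, t) ≠ (0, 0)) :
    ∃ α β : E →L[𝕜] 𝕜, s * RCLike.map 𝕜 ℂ (Λ.toModel p ![α, β]) +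
      t * RCLike.map 𝕜 ℂ (Λ₁.toModel p ![α, β]) ≠ 0 :=
  hgen p s t hst

theorem Represents.extMul_inChart (hrep : Represents w Ω Λ)
    (he : e ∈ IsManifold.maximalAtlas 𝓘(𝕜, E) ∞ M) {y : E} (hy : y ∈ e.target)
    (α β : E →L[𝕜] 𝕜) :
    extMul α (extMul β (w.inChart e y)) = Λ.inChart e y ![α, β] • Ω.inChart e y := by
  have h := hrep.toModel (e.symm y) (α.comp (chartDeriv e (e.symm y)))
    (β.comp (chartDeriv e (e.symm y)))
  have hid : ∀ γ : E →L[𝕜] 𝕜,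
      (γ.comp (chartDeriv e (e.symm y))).comp (chartDerivSymm e y) = γ := fun γ => by
    rw [ContinuousLinearMap.comp_assoc, chartDeriv_comp_chartDerivSymm he hy]
    rfl
  have h2 := congrArg (fun η => η.compContinuousLinearMap (chartDerivSymm (𝕜 := 𝕜) e y)) h
  simp only [extMul_compContinuousLinearMap, hid] at h2
  rw [BivectorField.inChart_apply]
  exact h2

theorem Represents.triple_components (hrep : Represents w Ω Λ) (b : Fin 3 → E)
    (he : e ∈ IsManifold.maximalAtlas 𝓘(𝕜, E) ∞ M) {y : E} (hy : y ∈ e.target)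
    (α β : E →L[𝕜] 𝕜) :
    triple (covectorCoords b α) (covectorCoords b β) (w.components b e y) =
      Λ.inChart e y ![α, β] * Ω.density b e y := by
  rw [DiffForm.components, ← extMul_extMul_apply_frame, hrep.extMul_inChart he hy]
  rfl

theorem density_ne_zero (b : Module.Basis (Fin 3) 𝕜 E) (hΩ0 : ∀ p, Ω p ≠ 0)
    (he : e ∈ IsManifold.maximalAtlas 𝓘(𝕜, E) ∞ M) {y : E} (hy : y ∈ e.target) :
    Ω.density b e y ≠ 0 := by
  intro h
  have h0 : Ω.inChart e y = 0 := eq_of_apply_basis_eq b (by rw [ContinuousAlternatingMap.coe_zero]; exact h)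
  have h1 := Ω.toModel_eq he (e.map_target hy)
  rw [e.right_inv hy, h0] at h1
  exact hΩ0 _ h1

theorem map_mul_rclike (x y : 𝕜) :
    RCLike.map 𝕜 ℂ (x * y) = RCLike.map 𝕜 ℂ x * RCLike.map 𝕜 ℂ y := by
  simp only [RCLike.map_apply]
  apply Complex.ext <;> simp [RCLike.mul_re, RCLike.mul_im]

theorem map_eq_zero_rclike {x : 𝕜} (h : RCLike.map 𝕜 ℂ x = 0) : x = 0 := by
  simp only [RCLike.map_apply] at h
  have h1 := congrArg Complex.re h
  have h2 := congrArg Complex.im h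
  simp at h1 h2
  exact RCLike.ext (by simpa using h1) (by simpa using h2)

/-- At each point, the `1`-forms representing a generic couple are independent. -/
theorem IsGeneric.cross_components_ne_zero (hgen : IsGeneric Λ Λ₁)
    (hrep : Represents w Ω Λ) (hrep₁ : Represents w₁ Ω Λ₁) (b : Module.Basis (Fin 3) 𝕜 E)
    (hΩ0 : ∀ p, Ω p ≠ 0) (he : e ∈ IsManifold.maximalAtlas 𝓘(𝕜, E) ∞ M) {y : E}
    (hy : y ∈ e.target) :
    w.components b e y ⨯₃ w₁.components b e y ≠ 0 := by
  intro hcross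
  set a := w.components b e y with ha
  set c := w₁.components b e y with hc
  -- Both bi-vectors share the density of Ω, so a linear relation between a and c over `𝕜` passes to
  -- them, against genericity.
  have key : ∀ s t : 𝕜, s • a + t • c = 0 → s = 0 ∧ t = 0 := by
    intro s t hst
    by_contra hne
    have hne' : (RCLike.map 𝕜 ℂ s, RCLike.map 𝕜 ℂ t) ≠ (0, 0) := fun h =>
      hne ⟨map_eq_zero_rclike (Prod.ext_iff.1 h).1, map_eq_zero_rclike (Prod.ext_iff.1 h).2⟩
    obtain ⟨α, β, hαβ⟩ := hgen.toModel (e.symm y) hne'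
    apply hαβ
    rw [← map_mul_rclike, ← map_mul_rclike, ← map_add]
    have hid : ∀ γ : E →L[𝕜] 𝕜,
        (γ.comp (chartDerivSymm e y)).comp (chartDeriv e (e.symm y)) = γ := fun γ => by
      rw [ContinuousLinearMap.comp_assoc, chartDerivSymm_comp_chartDeriv' he hy]
      rfl
    have h1 := hrep.triple_components b he hy (α.comp (chartDerivSymm e y))
      (β.comp (chartDerivSymm e y))
    have h2 := hrep₁.triple_components b he hy (α.comp (chartDerivSymm e y))
      (β.comp (chartDerivSymm e y))
    rw [BivectorField.inChart_apply, hid, hid] at h1 h2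
    have h3 : s * triple (covectorCoords b (α.comp (chartDerivSymm e y)))
        (covectorCoords b (β.comp (chartDerivSymm e y))) a +
        t * triple (covectorCoords b (α.comp (chartDerivSymm e y)))
        (covectorCoords b (β.comp (chartDerivSymm e y))) c = 0 := by
      have e0 := congrFun hst 0
      have e1 := congrFun hst 1
      have e2 := congrFun hst 2
      simp only [Pi.add_apply, Pi.smul_apply, smul_eq_mul, Pi.zero_apply] at e0 e1 e2
      simp only [triple_apply]
      generalize covectorCoords b (α.comp (chartDerivSymm e y)) = x
      generalize covectorCoords b (β.comp (chartDerivSymm e y)) = x'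
      linear_combination (x 1 * x' 2 - x 2 * x' 1) * e0 + (x 2 * x' 0 - x 0 * x' 2) * e1 +
        (x 0 * x' 1 - x 1 * x' 0) * e2
    rw [h1, h2] at h3
    have h4 : (s * Λ.toModel (e.symm y) ![α, β] + t * Λ₁.toModel (e.symm y) ![α, β]) *
        Ω.density b e y = 0 := by linear_combination h3
    rcases mul_eq_zero.1 h4 with h5 | h5
    · exact (congrArg (RCLike.map 𝕜 ℂ) h5).trans (map_zero _)
    · exact absurd h5 (density_ne_zero b hΩ0 he hy)
  -- If a ⨯ c = 0, then c i • a - a i • c = 0 for every i, so `key` gives a = 0. The relation 1 • a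
  -- + 0 • c = 0 is then the contradiction.
  have hz : ∀ i, a i = 0 := by
    intro i
    have h := (key (c i) (- a i) (funext fun j => by
      simp [mul_comm (c i), mul_eq_mul_of_cross_eq_zero hcross i j])).2
    simpa using h
  have : (1 : 𝕜) = 0 := (key 1 0 (by ext j; simp [hz])).1
  exact one_ne_zero this

end Representation
-- The equations dω = λ ∧ ω and dλ = 0 in a chart.
section Equations

variable {𝕜 : Type*} [RCLike 𝕜] {E : Type*} [NormedAddCommGroup E] [NormedSpace 𝕜 E]
  {M : Type*} [TopologicalSpace M] [ChartedSpace E M]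
  {e : OpenPartialHomeomorph M E} {w w₁ lam : DiffForm 𝕜 E M 1} {Ω : DiffForm 𝕜 E M 3}
  {Λ Λ₁ : BivectorField 𝕜 E M}

theorem DiffForm.eq_iff_inChart_eq {k : ℕ} {η ζ : DiffForm 𝕜 E M k}
    (he : e ∈ IsManifold.maximalAtlas 𝓘(𝕜, E) ∞ M) {p : M} (hp : p ∈ e.source) :
    η p = ζ p ↔ η.inChart e (e p) = ζ.inChart e (e p) := by
  constructor
  · intro h
    have h' : η.toModel p = ζ.toModel p := h
    rw [DiffForm.inChart_eq, DiffForm.inChart_eq, e.left_inv hp, h']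
  · intro h
    have h1 := η.toModel_eq he hp
    rw [h, ← ζ.toModel_eq he hp] at h1
    exact h1

theorem inChart_wedge (lam w : DiffForm 𝕜 E M 1) (e : OpenPartialHomeomorph M E) (y : E) :
    DiffForm.inChart (fun p => wedge (lam.covector p) (w p)) e y =
      extMul (toCovector (lam.inChart e y)) (w.inChart e y) := by
  change (extMul (toCovector (lam.toModel (e.symm y)))
    (w.toModel (e.symm y))).compContinuousLinearMap (chartDerivSymm e y) = _
  rw [extMul_compContinuousLinearMap, toCovector_compContinuousLinearMap]
  rfl

variable [IsManifold 𝓘(𝕜, E) ∞ M]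

theorem DiffForm.IsSmooth.twoCoords_d (hw : w.IsSmooth) (b : Fin 3 → E)
    (he : e ∈ IsManifold.maximalAtlas 𝓘(𝕜, E) ∞ M) {y : E} (hy : y ∈ e.target) :
    twoCoords b (w.d.inChart e y) = curl b (w.components b e) y := by
  rw [hw.inChart_d he hy, twoCoords_extDeriv b (hw.differentiableAt_inChart he hy)]
  rfl

theorem DiffForm.IsSmooth.d_eq_wedge_iff (hw : w.IsSmooth) (b : Module.Basis (Fin 3) 𝕜 E)
    (he : e ∈ IsManifold.maximalAtlas 𝓘(𝕜, E) ∞ M) {p : M} (hp : p ∈ e.source) :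
    w.d p = wedge (lam.covector p) (w p) ↔
      curl b (w.components b e) (e p) = lam.components b e (e p) ⨯₃ w.components b e (e p) := by
  rw [DiffForm.eq_iff_inChart_eq (η := w.d) (ζ := fun p => wedge (lam.covector p) (w p)) he hp,
    inChart_wedge, ← hw.twoCoords_d b he (e.map_source hp)]
  have h := twoCoords_extMul b (toCovector (lam.inChart e (e p))) (w.inChart e (e p))
  rw [covectorCoords_toCovector] at h
  rw [DiffForm.components, DiffForm.components, ← h]
  exact ⟨fun h => congrArg _ h, fun h => eq_of_twoCoords_eq b h⟩

theorem DiffForm.IsSmooth.d_eq_zero_iff (hw : w.IsSmooth) (b : Module.Basis (Fin 3) 𝕜 E)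
    (he : e ∈ IsManifold.maximalAtlas 𝓘(𝕜, E) ∞ M) {p : M} (hp : p ∈ e.source) :
    w.d p = 0 ↔ curl b (w.components b e) (e p) = 0 := by
  refine (DiffForm.eq_iff_inChart_eq (η := w.d) (ζ := 0) he hp).trans ?_
  rw [← hw.twoCoords_d b he (e.map_source hp)]
  have h0 : DiffForm.inChart (0 : DiffForm 𝕜 E M 2) e (e p) = 0 := rfl
  have h1 : twoCoords b (0 : E [⋀^Fin 2]→L[𝕜] 𝕜) = 0 := by
    ext i; fin_cases i <;> rfl
  rw [h0]
  exact ⟨fun h => by rw [h, h1], fun h => eq_of_twoCoords_eq b (by rw [h, h1])⟩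

theorem DiffForm.IsSmooth.contDiffOn_components [FiniteDimensional 𝕜 E] (hw : w.IsSmooth)
    (b : Module.Basis (Fin 3) 𝕜 E) (he : e ∈ IsManifold.maximalAtlas 𝓘(𝕜, E) ∞ M) :
    ContDiffOn 𝕜 ∞ (w.components b e) e.target :=
  contDiffOn_pi.2 fun _ => hw.contDiffOn_inChart_apply b he _

theorem DiffForm.IsSmooth.contDiffOn_density [FiniteDimensional 𝕜 E] (hΩ : Ω.IsSmooth)
    (b : Module.Basis (Fin 3) 𝕜 E) (he : e ∈ IsManifold.maximalAtlas 𝓘(𝕜, E) ∞ M) :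
    ContDiffOn 𝕜 ∞ (Ω.density b e) e.target :=
  hΩ.contDiffOn_inChart_apply b he _

theorem differentiableAt_of_contDiffOn {F : Type*} [NormedAddCommGroup F] [NormedSpace 𝕜 F] {f : E → F}
    {U : Set E} (hf : ContDiffOn 𝕜 ∞ f U) (hU : IsOpen U) {y : E} (hy : y ∈ U) :
    DifferentiableAt 𝕜 f y :=
  (hf.contDiffAt (hU.mem_nhds hy)).differentiableAt (by simp)

end Equations

/-! ### Brackets, and the Jacobi identity as integrability of the representing form. -/

section Brackets

variable {𝕜 : Type*} [RCLike 𝕜] {E : Type*} [NormedAddCommGroup E] [NormedSpace 𝕜 E]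
  {M : Type*} [TopologicalSpace M] [ChartedSpace E M]
  {e : OpenPartialHomeomorph M E} {w w₁ lam : DiffForm 𝕜 E M 1} {Ω : DiffForm 𝕜 E M 3}
  {Λ Λ₁ : BivectorField 𝕜 E M}

theorem diff_eq_comp_chartDeriv (he : e ∈ IsManifold.maximalAtlas 𝓘(𝕜, E) ∞ M) {y : E}
    (hy : y ∈ e.target) {f : M → 𝕜} (hf : MDifferentiableAt 𝓘(𝕜, E) 𝓘(𝕜, 𝕜) f (e.symm y)) :
    diff f (e.symm y) = (fderiv 𝕜 (f ∘ e.symm) y).comp (chartDeriv e (e.symm y)) := by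
  let D : E →L[𝕜] 𝕜 := diff f (e.symm y)
  have h1 : fderiv 𝕜 (f ∘ e.symm) y = D.comp (chartDerivSymm e y) := by
    rw [← mfderiv_eq_fderiv]
    exact mfderiv_comp y hf ((mdifferentiable_of_mem_maximalAtlas he).mdifferentiableAt_symm hy)
  rw [h1]
  have h2 := chartDerivSymm_comp_chartDeriv' (𝕜 := 𝕜) he hy
  ext v
  exact (congrArg (fun A : E →L[𝕜] E => D (A v)) h2).symm

theorem bracket_eq_inChart (he : e ∈ IsManifold.maximalAtlas 𝓘(𝕜, E) ∞ M) {y : E}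
    (hy : y ∈ e.target) {f g : M → 𝕜} (hf : MDifferentiableAt 𝓘(𝕜, E) 𝓘(𝕜, 𝕜) f (e.symm y))
    (hg : MDifferentiableAt 𝓘(𝕜, E) 𝓘(𝕜, 𝕜) g (e.symm y)) :
    Λ.bracket f g (e.symm y) =
      Λ.inChart e y ![fderiv 𝕜 (f ∘ e.symm) y, fderiv 𝕜 (g ∘ e.symm) y] := by
  rw [BivectorField.bracket, BivectorField.inChart_apply, diff_eq_comp_chartDeriv he hy hf,
    diff_eq_comp_chartDeriv he hy hg]
  rfl

theorem Represents.triple_grad (hrep : Represents w Ω Λ) (b : Fin 3 → E)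
    (he : e ∈ IsManifold.maximalAtlas 𝓘(𝕜, E) ∞ M) {y : E}
    (hy : y ∈ e.target) {f g : M → 𝕜} (hf : MDifferentiableAt 𝓘(𝕜, E) 𝓘(𝕜, 𝕜) f (e.symm y))
    (hg : MDifferentiableAt 𝓘(𝕜, E) 𝓘(𝕜, 𝕜) g (e.symm y)) :
    triple (grad b (f ∘ e.symm) y) (grad b (g ∘ e.symm) y) (w.components b e y) =
      Λ.bracket f g (e.symm y) * Ω.density b e y := by
  rw [bracket_eq_inChart he hy hf hg, ← hrep.triple_components b he hy]
  rfl

theorem contDiffOn_comp_symm (he : e ∈ IsManifold.maximalAtlas 𝓘(𝕜, E) ∞ M) {f : M → 𝕜} {V : Set M}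
    (hf : ContMDiffOn 𝓘(𝕜, E) 𝓘(𝕜, 𝕜) ∞ f V) :
    ContDiffOn 𝕜 ∞ (f ∘ e.symm) (e.target ∩ e.symm ⁻¹' V) := by
  rw [← contMDiffOn_iff_contDiffOn]
  exact hf.comp ((contMDiffOn_symm_of_mem_maximalAtlas he).mono Set.inter_subset_left)
    fun y hy => hy.2

theorem mdifferentiableAt_of_comp_symm (he : e ∈ IsManifold.maximalAtlas 𝓘(𝕜, E) ∞ M) {y : E}
    (hy : y ∈ e.target) {f : M → 𝕜} (hf : DifferentiableAt 𝕜 (f ∘ e.symm) y) :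
    MDifferentiableAt 𝓘(𝕜, E) 𝓘(𝕜, 𝕜) f (e.symm y) := by
  have h1 : MDifferentiableAt 𝓘(𝕜, E) 𝓘(𝕜, 𝕜) (f ∘ e.symm) (e (e.symm y)) := by
    rw [e.right_inv hy]
    exact hf.mdifferentiableAt
  have h2 := h1.comp (e.symm y)
    ((mdifferentiable_of_mem_maximalAtlas he).mdifferentiableAt (e.map_target hy))
  refine h2.congr_of_eventuallyEq ?_
  filter_upwards [e.open_source.mem_nhds (e.map_target hy)] with q hq
  simp [e.left_inv hq]

/-- The Jacobi identity of a bi-vector in terms of the `1`-form that represents it. -/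
theorem Represents.jacobi (hrep : Represents w Ω Λ) [FiniteDimensional 𝕜 E]
    [IsManifold 𝓘(𝕜, E) ∞ M] (b : Module.Basis (Fin 3) 𝕜 E)
    (hw : w.IsSmooth) (hΩ : Ω.IsSmooth) (hΩ0 : ∀ p, Ω p ≠ 0)
    (he : e ∈ IsManifold.maximalAtlas 𝓘(𝕜, E) ∞ M) {y : E} (hy : y ∈ e.target)
    {V : Set M} (hV : IsOpen V) (hyV : e.symm y ∈ V) {f g h : M → 𝕜}
    (hf : ContMDiffOn 𝓘(𝕜, E) 𝓘(𝕜, 𝕜) ∞ f V) (hg : ContMDiffOn 𝓘(𝕜, E) 𝓘(𝕜, 𝕜) ∞ g V)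
    (hh : ContMDiffOn 𝓘(𝕜, E) 𝓘(𝕜, 𝕜) ∞ h V) :
    (Λ.bracket f (Λ.bracket g h) (e.symm y) + Λ.bracket g (Λ.bracket h f) (e.symm y) +
      Λ.bracket h (Λ.bracket f g) (e.symm y)) * Ω.density b e y ^ 2 =
      - (w.components b e y ⬝ᵥ curl b (w.components b e) y) *
        triple (grad b (f ∘ e.symm) y) (grad b (g ∘ e.symm) y) (grad b (h ∘ e.symm) y) := by
  have hO : IsOpen (e.target ∩ e.symm ⁻¹' V) := e.symm.isOpen_inter_preimage hV
  have hyO : y ∈ e.target ∩ e.symm ⁻¹' V := ⟨hy, hyV⟩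
  have mdiff : ∀ {f : M → 𝕜}, ContMDiffOn 𝓘(𝕜, E) 𝓘(𝕜, 𝕜) ∞ f V → ∀ z ∈ e.target ∩ e.symm ⁻¹' V,
      MDifferentiableAt 𝓘(𝕜, E) 𝓘(𝕜, 𝕜) f (e.symm z) := fun hf z hz =>
    (hf.contMDiffAt (hV.mem_nhds hz.2)).mdifferentiableAt (by simp)
  have c2 : ∀ {f : M → 𝕜}, ContMDiffOn 𝓘(𝕜, E) 𝓘(𝕜, 𝕜) ∞ f V → ContDiffAt 𝕜 2 (f ∘ e.symm) y :=
    fun hf => ((contDiffOn_comp_symm he hf).contDiffAt (hO.mem_nhds hyO)).of_le two_le_infty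
  have hW := (hw.contDiffOn_components b he).contDiffAt (e.open_target.mem_nhds hy)
    |>.differentiableAt (by simp)
  have hρ := (hΩ.contDiffOn_density b he).contDiffAt (e.open_target.mem_nhds hy)
    |>.differentiableAt (by simp)
  have hρ0 := density_ne_zero b hΩ0 he hy
  have hev : ∀ {f g : M → 𝕜}, ContMDiffOn 𝓘(𝕜, E) 𝓘(𝕜, 𝕜) ∞ f V →
      ContMDiffOn 𝓘(𝕜, E) 𝓘(𝕜, 𝕜) ∞ g V → ∀ᶠ z in 𝓝 y,
      triple (grad b (f ∘ e.symm) z) (grad b (g ∘ e.symm) z) (w.components b e z) =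
        (Λ.bracket f g ∘ e.symm) z * Ω.density b e z := by
    intro f g hf hg
    filter_upwards [hO.mem_nhds hyO] with z hz
    exact hrep.triple_grad b he hz.1 (mdiff hf z hz) (mdiff hg z hz)
  have hbr : ∀ {f g : M → 𝕜}, ContMDiffOn 𝓘(𝕜, E) 𝓘(𝕜, 𝕜) ∞ f V →
      ContMDiffOn 𝓘(𝕜, E) 𝓘(𝕜, 𝕜) ∞ g V →
      DifferentiableAt 𝕜 (Λ.bracket f g ∘ e.symm) y := by
    intro f g hf hg
    have h4 := differentiableAt_triple (differentiableAt_grad b (c2 hf))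
      (differentiableAt_grad b (c2 hg)) hW
    -- Differentiability of the bracket comes from that of W and ρ, as it is a triple product
    -- divided by ρ.
    refine (h4.mul (hρ.inv hρ0)).congr_of_eventuallyEq ?_
    filter_upwards [hev hf hg, e.open_target.mem_nhds hy] with z hz hzt
    simp only [Pi.mul_apply]
    rw [hz]
    exact (mul_inv_cancel_right₀ (density_ne_zero b hΩ0 he hzt) _).symm
  have key := jacobi_triple b (c2 hf) (c2 hg) (c2 hh) hρ hρ0 hW (hbr hf hg) (hbr hg hh) (hbr hh hf)
    (hev hf hg) (hev hg hh) (hev hh hf)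
  have hmb : ∀ {f g : M → 𝕜}, ContMDiffOn 𝓘(𝕜, E) 𝓘(𝕜, 𝕜) ∞ f V →
      ContMDiffOn 𝓘(𝕜, E) 𝓘(𝕜, 𝕜) ∞ g V →
      MDifferentiableAt 𝓘(𝕜, E) 𝓘(𝕜, 𝕜) (Λ.bracket f g) (e.symm y) := fun hf hg =>
    mdifferentiableAt_of_comp_symm he hy (hbr hf hg)
  -- The outer brackets contribute a second factor ρ, whence the square of the density.
  rw [hrep.triple_grad b he hy (mdiff hf y hyO) (hmb hg hh),
    hrep.triple_grad b he hy (mdiff hg y hyO) (hmb hh hf),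
    hrep.triple_grad b he hy (mdiff hh y hyO) (hmb hf hg)] at key
  rw [← key]
  ring

/-- A bi-vector satisfying the Jacobi identity is represented by an integrable `1`-form. -/
theorem Represents.dot_curl_eq_zero (hrep : Represents w Ω Λ) [FiniteDimensional 𝕜 E]
    [IsManifold 𝓘(𝕜, E) ∞ M] (b : Module.Basis (Fin 3) 𝕜 E)
    (hw : w.IsSmooth) (hΩ : Ω.IsSmooth) (hΩ0 : ∀ p, Ω p ≠ 0)
    (he : e ∈ IsManifold.maximalAtlas 𝓘(𝕜, E) ∞ M) {U : Set M} (hU : IsOpen U)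
    (hΛ : Λ.IsPoissonOn U) {y : E} (hy : y ∈ e.target) (hyU : e.symm y ∈ U) :
    w.components b e y ⬝ᵥ curl b (w.components b e) y = 0 := by
  -- Testing on the chart coordinates suffices: their gradients are the standard basis, with triple
  -- product 1.
  let x : Fin 3 → M → 𝕜 := fun i q => b.equivFunL (e q) i
  have hx : ∀ i, ContMDiffOn 𝓘(𝕜, E) 𝓘(𝕜, 𝕜) ∞ (x i) (U ∩ e.source) := by
    intro i
    have h1 : ContDiff 𝕜 ∞ fun z : E => b.equivFunL z i :=
      contDiff_pi.1 b.equivFunL.contDiff i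
    exact h1.contMDiff.comp_contMDiffOn
      ((contMDiffOn_of_mem_maximalAtlas he).mono Set.inter_subset_right)
  have hg : ∀ i, grad b (x i ∘ e.symm) y = Pi.single i 1 := by
    intro i
    have h1 : x i ∘ e.symm =ᶠ[𝓝 y]
        ((ContinuousLinearMap.proj i).comp (b.equivFunL : E →L[𝕜] Fin 3 → 𝕜) : E →L[𝕜] 𝕜) := by
      filter_upwards [e.open_target.mem_nhds hy] with z hz
      simp [x, e.right_inv hz]
    rw [grad_eventuallyEq b h1, grad, ContinuousLinearMap.fderiv]
    ext j
    simp [covectorCoords, Finsupp.single_apply, Pi.single_apply, eq_comm]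
  have hJ := hrep.jacobi b hw hΩ hΩ0 he hy (hU.inter e.open_source) ⟨hyU, e.map_target hy⟩
    (hx 0) (hx 1) (hx 2)
  rw [hΛ.2 _ (hU.inter e.open_source) Set.inter_subset_left _ _ _ (hx 0) (hx 1) (hx 2) _
    ⟨hyU, e.map_target hy⟩, hg, hg, hg, zero_mul] at hJ
  simpa [triple_apply] using hJ.symm

/-- A bi-vector represented by an integrable `1`-form satisfies the Jacobi identity. -/
theorem Represents.isPoissonOn (hrep : Represents w Ω Λ) [FiniteDimensional 𝕜 E]
    [IsManifold 𝓘(𝕜, E) ∞ M] (b : Module.Basis (Fin 3) 𝕜 E)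
    (hw : w.IsSmooth) (hΩ : Ω.IsSmooth) (hΩ0 : ∀ p, Ω p ≠ 0) {U : Set M} (hΛ : Λ.IsSmoothOn U)
    (h0 : ∀ p, w.components b (chartAt E p) (chartAt E p p) ⬝ᵥ
      curl b (w.components b (chartAt E p)) (chartAt E p p) = 0) :
    Λ.IsPoissonOn U := by
  refine ⟨hΛ, fun V hV _ f g h hf hg hh p hp => ?_⟩
  have he := IsManifold.chart_mem_maximalAtlas (I := 𝓘(𝕜, E)) (n := ∞) p
  have hps := mem_chart_source E p
  have hl := (chartAt E p).left_inv hps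
  have hJ := hrep.jacobi b hw hΩ hΩ0 he ((chartAt E p).map_source hps) hV
    (by rw [hl]; exact hp) hf hg hh
  rw [h0 p, neg_zero, zero_mul, hl] at hJ
  exact (mul_eq_zero.1 hJ).resolve_right
    (pow_ne_zero _ (density_ne_zero b hΩ0 he ((chartAt E p).map_source hps)))

end Brackets
-- Poisson pairs, existence of λ, and the kernel of dλ.
section Pairs

variable {𝕜 : Type*} [RCLike 𝕜] {E : Type*} [NormedAddCommGroup E] [NormedSpace 𝕜 E]
  {M : Type*} [TopologicalSpace M] [ChartedSpace E M]
  {e : OpenPartialHomeomorph M E} {w w₁ lam : DiffForm 𝕜 E M 1} {Ω : DiffForm 𝕜 E M 3}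
  {Λ Λ₁ : BivectorField 𝕜 E M}

theorem extMul_add {k : ℕ} (α : E →L[𝕜] 𝕜) (η ζ : E [⋀^Fin k]→L[𝕜] 𝕜) :
    extMul α (η + ζ) = extMul α η + extMul α ζ := by
  rw [extMul, extMul, extMul, ← ContinuousAlternatingMap.alternatizeUncurryFin_add]
  congr 1
  ext u v
  simp

theorem Represents.add (hrep : Represents w Ω Λ) (hrep₁ : Represents w₁ Ω Λ₁) :
    Represents (fun p => w p + w₁ p) Ω (fun p => Λ p + Λ₁ p) := by
  intro p α β
  have h : ∀ α β : E →L[𝕜] 𝕜, extMul α (extMul β (w.toModel p + w₁.toModel p)) =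
      (Λ.toModel p ![α, β] + Λ₁.toModel p ![α, β]) • Ω.toModel p := fun α β => by
    rw [extMul_add, extMul_add, hrep.toModel, hrep₁.toModel]
    exact (add_smul _ _ _).symm
  exact h α β

theorem DiffForm.IsSmooth.add (hw : w.IsSmooth) (hw₁ : w₁.IsSmooth) :
    DiffForm.IsSmooth (fun p => w p + w₁ p) := fun e he =>
  (hw e he).add (hw₁ e he)

theorem isSmoothOn_add {U : Set M} (hΛ : Λ.IsSmoothOn U) (hΛ₁ : Λ₁.IsSmoothOn U) :
    BivectorField.IsSmoothOn (fun p => Λ p + Λ₁ p) U := fun e he =>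
  (hΛ e he).add (hΛ₁ e he)

/-- The same λ serves the sum: d(ω + ω₁) = λ ∧ (ω + ω₁), so ω + ω₁ is integrable. -/
theorem isPoissonPair_of_d_eq_wedge [FiniteDimensional 𝕜 E] [IsManifold 𝓘(𝕜, E) ∞ M]
    (b : Module.Basis (Fin 3) 𝕜 E) (hΛ : Λ.IsPoisson) (hΛ₁ : Λ₁.IsPoisson)
    (hw : w.IsSmooth) (hw₁ : w₁.IsSmooth) (hΩ : Ω.IsSmooth) (hΩ0 : ∀ p, Ω p ≠ 0)
    (hrep : Represents w Ω Λ) (hrep₁ : Represents w₁ Ω Λ₁)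
    (h : ∀ p, w.d p = wedge (lam.covector p) (w p))
    (h₁ : ∀ p, w₁.d p = wedge (lam.covector p) (w₁ p)) : IsPoissonPair Λ Λ₁ := by
  refine fun p => ⟨Set.univ, isOpen_univ, trivial, hΛ, hΛ₁, ?_⟩
  refine (hrep.add hrep₁).isPoissonOn b (hw.add hw₁) hΩ hΩ0 (isSmoothOn_add hΛ.1 hΛ₁.1) fun q => ?_
  have he := IsManifold.chart_mem_maximalAtlas (I := 𝓘(𝕜, E)) (n := ∞) q
  have hq := mem_chart_source E q
  have ht := (chartAt E q).map_source hq
  have e1 := (hw.d_eq_wedge_iff b he hq).1 (h q)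
  have e2 := (hw₁.d_eq_wedge_iff b he hq).1 (h₁ q)
  have hadd := curl_add b
    (differentiableAt_of_contDiffOn (hw.contDiffOn_components b he) (chartAt E q).open_target ht)
    (differentiableAt_of_contDiffOn (hw₁.contDiffOn_components b he) (chartAt E q).open_target ht)
  rw [e1, e2, ← map_add] at hadd
  change (w.components b (chartAt E q) (chartAt E q q) +
    w₁.components b (chartAt E q) (chartAt E q q)) ⬝ᵥ curl b (fun z =>
    w.components b (chartAt E q) z + w₁.components b (chartAt E q) z) _ = 0
  rw [hadd, dot_cross_self]

theorem contDiffOn_curl (b : Fin 3 → E) {W : E → Fin 3 → 𝕜} {U : Set E} (hU : IsOpen U)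
    (hW : ContDiffOn 𝕜 ∞ W U) : ContDiffOn 𝕜 ∞ (curl b W) U := by
  have h : ∀ v i, ContDiffOn 𝕜 ∞ (fun y => fderiv 𝕜 W y v i) U := fun v i =>
    contDiffOn_pi.1 ((hW.fderiv_of_isOpen hU (by simp)).clm_apply contDiffOn_const) i
  refine contDiffOn_pi.2 fun i => ?_
  fin_cases i
  · exact (h (b 1) 2).sub (h (b 2) 1)
  · exact (h (b 2) 0).sub (h (b 0) 2)
  · exact (h (b 0) 1).sub (h (b 1) 0)

theorem contDiffOn_dotProduct {V W : E → Fin 3 → 𝕜} {U : Set E} (hV : ContDiffOn 𝕜 ∞ V U)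
    (hW : ContDiffOn 𝕜 ∞ W U) : ContDiffOn 𝕜 ∞ (fun y => V y ⬝ᵥ W y) U :=
  ContDiffOn.sum fun i _ => (contDiffOn_pi.1 hV i).mul (contDiffOn_pi.1 hW i)

/-- The `1`-form with given components in a basis. -/
noncomputable def oneFormOfCoords [FiniteDimensional 𝕜 E] (b : Module.Basis (Fin 3) 𝕜 E) :
    (Fin 3 → 𝕜) →L[𝕜] E [⋀^Fin 1]→L[𝕜] 𝕜 :=
  ((ContinuousAlternatingMap.ofSubsingletonLIE (𝕜 := 𝕜) (E := E) (F := 𝕜) (0 : Fin 1)).toContinuousLinearEquiv :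
    (E →L[𝕜] 𝕜) →L[𝕜] E [⋀^Fin 1]→L[𝕜] 𝕜).comp (covectorOfCoords b)

theorem oneCoords_oneFormOfCoords [FiniteDimensional 𝕜 E] (b : Module.Basis (Fin 3) 𝕜 E)
    (x : Fin 3 → 𝕜) : oneCoords b (oneFormOfCoords b x) = x :=
  covectorCoords_covectorOfCoords b x

theorem DiffForm.isSmooth_of_components [FiniteDimensional 𝕜 E] (b : Module.Basis (Fin 3) 𝕜 E)
    (h : ∀ e ∈ atlas E M, ContDiffOn 𝕜 ∞ (lam.components b e) e.target) : lam.IsSmooth := by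
  intro e he
  refine ((oneFormOfCoords b).contDiff.comp_contDiffOn (h e he)).congr fun y _ => ?_
  exact eq_of_oneCoords_eq b (oneCoords_oneFormOfCoords b _).symm

/-- A solution of `dw = λ ∧ w`, `dw₁ = λ ∧ w₁` is smooth if `w` and `w₁` are independent. -/
theorem DiffForm.isSmooth_of_d_eq_wedge [FiniteDimensional 𝕜 E] [IsManifold 𝓘(𝕜, E) ∞ M]
    (b : Module.Basis (Fin 3) 𝕜 E) (hw : w.IsSmooth) (hw₁ : w₁.IsSmooth)
    (hind : ∀ e ∈ IsManifold.maximalAtlas 𝓘(𝕜, E) ∞ M, ∀ y ∈ e.target,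
      w.components b e y ⨯₃ w₁.components b e y ≠ 0)
    (h : ∀ p, w.d p = wedge (lam.covector p) (w p))
    (h₁ : ∀ p, w₁.d p = wedge (lam.covector p) (w₁ p)) : lam.IsSmooth := by
  refine DiffForm.isSmooth_of_components b fun e he y hy => ContDiffAt.contDiffWithinAt ?_
  have he' := IsManifold.subset_maximalAtlas (I := 𝓘(𝕜, E)) (n := ∞) he
  have hW := hw.contDiffOn_components b he'
  have hW₁ := hw₁.contDiffOn_components b he'
  have hC := contDiffOn_curl b e.open_target hW
  have hC₁ := contDiffOn_curl b e.open_target hW₁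
  -- A constant u independent of W and W₁ near the point; `eq_of_cross_eq` then writes λ as a
  -- quotient of functions smooth there.
  obtain ⟨u, hu⟩ := exists_ne_zero_of_cross_ne_zero (hind e he' y hy)
  have hD : ContDiffOn 𝕜 ∞ (fun z => triple u (w.components b e z) (w₁.components b e z))
      e.target := by
    have h1 := fun i => contDiffOn_pi.1 hW i
    have h2 := fun i => contDiffOn_pi.1 hW₁ i
    simp only [triple_apply]
    have := h1 0; have := h1 1; have := h1 2; have := h2 0; have := h2 1; have := h2 2
    fun_prop
  have hnum : ContDiffOn 𝕜 ∞ (fun z =>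
      (curl b (w.components b e) z ⬝ᵥ w₁.components b e z) • u +
      (curl b (w₁.components b e) z ⬝ᵥ u) • w.components b e z -
      (curl b (w.components b e) z ⬝ᵥ u) • w₁.components b e z) e.target :=
    (((contDiffOn_dotProduct hC hW₁).smul contDiffOn_const).add
      ((contDiffOn_dotProduct hC₁ contDiffOn_const).smul hW)).sub
      ((contDiffOn_dotProduct hC contDiffOn_const).smul hW₁)
  have hnhds := e.open_target.mem_nhds hy
  have hDy := hD.contDiffAt hnhds
  refine ((hDy.inv hu).smul (hnum.contDiffAt hnhds)).congr_of_eventuallyEq ?_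
  filter_upwards [hnhds, hDy.continuousAt.eventually_ne hu] with z hz hz0
  have e1 := (hw.d_eq_wedge_iff b he' (e.map_target hz)).1 (h _)
  have e2 := (hw₁.d_eq_wedge_iff b he' (e.map_target hz)).1 (h₁ _)
  rw [e.right_inv hz] at e1 e2
  have h3 := eq_of_cross_eq (u := u) e1 e2
  exact (eq_inv_smul_iff₀ hz0).2 h3

/-- Integrability of ω, ω₁ and ω + ω₁ makes the system for λ solvable at each point. The form λ is
chosen point by point, in the preferred chart; its smoothness follows from the equations. -/
theorem exists_d_eq_wedge_of_isPoissonPair [FiniteDimensional 𝕜 E] [IsManifold 𝓘(𝕜, E) ∞ M]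
    (b : Module.Basis (Fin 3) 𝕜 E) (hpair : IsPoissonPair Λ Λ₁)
    (hw : w.IsSmooth) (hw₁ : w₁.IsSmooth) (hΩ : Ω.IsSmooth) (hΩ0 : ∀ p, Ω p ≠ 0)
    (hrep : Represents w Ω Λ) (hrep₁ : Represents w₁ Ω Λ₁)
    (hind : ∀ e ∈ IsManifold.maximalAtlas 𝓘(𝕜, E) ∞ M, ∀ y ∈ e.target,
      w.components b e y ⨯₃ w₁.components b e y ≠ 0) :
    ∃ lam : DiffForm 𝕜 E M 1, lam.IsSmooth ∧
      (∀ p, w.d p = wedge (lam.covector p) (w p)) ∧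
      (∀ p, w₁.d p = wedge (lam.covector p) (w₁ p)) := by
  have hex : ∀ p : M, ∃ x : Fin 3 → 𝕜,
      curl b (w.components b (chartAt E p)) (chartAt E p p) =
        x ⨯₃ w.components b (chartAt E p) (chartAt E p p) ∧
      curl b (w₁.components b (chartAt E p)) (chartAt E p p) =
        x ⨯₃ w₁.components b (chartAt E p) (chartAt E p p) := by
    intro p
    have he := IsManifold.chart_mem_maximalAtlas (I := 𝓘(𝕜, E)) (n := ∞) p
    have hp := mem_chart_source E p
    have ht := (chartAt E p).map_source hp
    obtain ⟨U, hU, hpU, hΛ, hΛ₁, hadd⟩ := hpair p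
    have hpU' : (chartAt E p).symm (chartAt E p p) ∈ U := by
      rwa [(chartAt E p).left_inv hp]
    have h3 := (hrep.add hrep₁).dot_curl_eq_zero b (hw.add hw₁) hΩ hΩ0 he hU hadd ht hpU'
    have hcurl := curl_add b
      (differentiableAt_of_contDiffOn (hw.contDiffOn_components b he) (chartAt E p).open_target ht)
      (differentiableAt_of_contDiffOn (hw₁.contDiffOn_components b he) (chartAt E p).open_target ht)
    refine exists_cross_eq (hind _ he _ ht)
      (hrep.dot_curl_eq_zero b hw hΩ hΩ0 he hU hΛ ht hpU')
      (hrep₁.dot_curl_eq_zero b hw₁ hΩ hΩ0 he hU hΛ₁ ht hpU') ?_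
    rw [← hcurl]
    exact h3
  choose x hx hx₁ using hex
  let ℓ : M → E [⋀^Fin 1]→L[𝕜] 𝕜 := fun p =>
    (oneFormOfCoords b (x p)).compContinuousLinearMap (chartDeriv (chartAt E p) p)
  let lam : DiffForm 𝕜 E M 1 := ℓ
  have hcomp : ∀ p, lam.components b (chartAt E p) (chartAt E p p) = x p := by
    intro p
    have he := IsManifold.chart_mem_maximalAtlas (I := 𝓘(𝕜, E)) (n := ∞) p
    have hp := mem_chart_source E p
    have ht := (chartAt E p).map_source hp
    have hid := chartDeriv_comp_chartDerivSymm (𝕜 := 𝕜) he ht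
    rw [(chartAt E p).left_inv hp] at hid
    have h1 : lam.toModel p = (oneFormOfCoords b (x p)).compContinuousLinearMap
      (chartDeriv (𝕜 := 𝕜) (chartAt E p) p) := rfl
    conv_rhs => rw [← oneCoords_oneFormOfCoords b (x p)]
    rw [DiffForm.components, DiffForm.inChart_eq, (chartAt E p).left_inv hp, h1]
    congr 1
    ext v
    simp only [ContinuousAlternatingMap.compContinuousLinearMap_apply]
    congr 1
    ext i
    exact congrArg (fun A : E →L[𝕜] E => A (v i)) hid
  have hd : ∀ p, w.d p = wedge (lam.covector p) (w p) := fun p => by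
    rw [hw.d_eq_wedge_iff b (IsManifold.chart_mem_maximalAtlas (I := 𝓘(𝕜, E)) (n := ∞) p)
      (mem_chart_source E p), hcomp]
    exact hx p
  have hd₁ : ∀ p, w₁.d p = wedge (lam.covector p) (w₁ p) := fun p => by
    rw [hw₁.d_eq_wedge_iff b (IsManifold.chart_mem_maximalAtlas (I := 𝓘(𝕜, E)) (n := ∞) p)
      (mem_chart_source E p), hcomp]
    exact hx₁ p
  exact ⟨lam, DiffForm.isSmooth_of_d_eq_wedge b hw hw₁ hind hd hd₁, hd, hd₁⟩

/-- For v = Λ(α, ·), ω(v) Ω = Λ(α, ω) Ω = α ∧ ω ∧ ω = 0. -/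
theorem Represents.apply_eq_zero_of_mem_im (hrep : Represents w Ω Λ)
    (b : Module.Basis (Fin 3) 𝕜 E) {p : M} (hΩ0 : Ω p ≠ 0) {v : E}
    (hv : ∃ α : E →L[𝕜] 𝕜, ∀ β : E →L[𝕜] 𝕜, β v = Λ.toModel p ![α, β]) :
    w.toModel p ![v] = 0 := by
  obtain ⟨α, hα⟩ := hv
  have h2 : extMul α (extMul (toCovector (w.toModel p)) (w.toModel p)) = 0 := by
    apply eq_of_apply_basis_eq b
    rw [extMul_extMul_apply_frame, covectorCoords_toCovector, triple, cross_self]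
    simp
  rw [hrep.toModel] at h2
  rw [← toCovector_apply, hα]
  exact (smul_eq_zero.1 h2).resolve_right hΩ0

theorem im_inter_im_subset_ker_d [FiniteDimensional 𝕜 E] [IsManifold 𝓘(𝕜, E) ∞ M]
    (b : Module.Basis (Fin 3) 𝕜 E)
    (hw : w.IsSmooth) (hw₁ : w₁.IsSmooth) (hlam : lam.IsSmooth) (hΩ0 : ∀ p, Ω p ≠ 0)
    (hrep : Represents w Ω Λ) (hrep₁ : Represents w₁ Ω Λ₁)
    (hind : ∀ e ∈ IsManifold.maximalAtlas 𝓘(𝕜, E) ∞ M, ∀ y ∈ e.target,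
      w.components b e y ⨯₃ w₁.components b e y ≠ 0)
    (h : ∀ p, w.d p = wedge (lam.covector p) (w p))
    (h₁ : ∀ p, w₁.d p = wedge (lam.covector p) (w₁ p)) (p : M) :
    Λ.im p ∩ Λ₁.im p ⊆ lam.d.ker p := by
  rintro v ⟨hv, hv₁⟩ u
  have he := IsManifold.chart_mem_maximalAtlas (I := 𝓘(𝕜, E)) (n := ∞) p
  have hp := mem_chart_source E p
  set e := chartAt E p with hedef
  have ht := e.map_source hp
  set A : E →L[𝕜] E := chartDeriv e p with hA
  set η := lam.d.inChart e (e p) with hη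
  have hL := differentiableAt_of_contDiffOn (hlam.contDiffOn_components b he) e.open_target ht
  -- Contract ω ∧ dλ = 0 with v: as ω(v) = 0, this leaves ω ∧ dλ(v, ·) = 0.
  have orth : ∀ {w : DiffForm 𝕜 E M 1}, w.IsSmooth →
      (∀ p, w.d p = wedge (lam.covector p) (w p)) →
      w.toModel p ![(v : E)] = 0 → ∀ s t : E,
        w.inChart e (e p) ![s] * η ![A v, t] = w.inChart e (e p) ![t] * η ![A v, s] := by
    intro w hw h hv s t
    have hd := dot_curl_eq_zero_of_extDeriv (b := b) (θ := w.inChart e)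
      ((hw e (chart_mem_atlas E p)).contDiffAt (e.open_target.mem_nhds ht)) hL (by
        filter_upwards [e.open_target.mem_nhds ht] with z hz
        have := (hw.d_eq_wedge_iff b he (e.map_target hz)).1 (h _)
        rw [e.right_inv hz] at this
        exact this)
    rw [← hlam.twoCoords_d b he ht, ← covectorCoords_toCovector, ← extMul_apply_frame] at hd
    have h0 : extMul (toCovector (w.inChart e (e p))) η = 0 := eq_of_apply_basis_eq b hd
    have h1 := extMul_apply_three (toCovector (w.inChart e (e p))) η (A v) s t
    rw [h0, toCovector_apply, toCovector_apply, toCovector_apply] at h1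
    have h2 : w.inChart e (e p) ![A v] = 0 := by
      rw [w.toModel_eq he hp, ContinuousAlternatingMap.compContinuousLinearMap_apply] at hv
      rw [← hv]
      congr 1
      ext i
      fin_cases i
      rfl
    rw [h2, ContinuousAlternatingMap.coe_zero, Pi.zero_apply] at h1
    linear_combination h1
  have o := orth hw h (hrep.apply_eq_zero_of_mem_im b (hΩ0 p) hv)
  have o₁ := orth hw₁ h₁ (hrep₁.apply_eq_zero_of_mem_im b (hΩ0 p) hv₁)
  -- dλ(v, ·) has zero cross product with the independent W and W₁, as does 0, so the two agree.
  have hγ : (fun i => η ![A v, b i]) = (0 : Fin 3 → 𝕜) := by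
    refine cross_right_unique (hind e he _ ht) ?_ ?_
    · simp only [cross_apply, DiffForm.components, oneCoords, Pi.zero_apply]
      ext i
      fin_cases i <;> simp
      · linear_combination o (b 2) (b 1)
      · linear_combination o (b 0) (b 2)
      · linear_combination o (b 1) (b 0)
    · simp only [cross_apply, DiffForm.components, oneCoords, Pi.zero_apply]
      ext i
      fin_cases i <;> simp
      · linear_combination o₁ (b 2) (b 1)
      · linear_combination o₁ (b 0) (b 2)
      · linear_combination o₁ (b 1) (b 0)
  have hzero : ∀ s : E, η ![A v, s] = 0 := by
    intro s
    -- To pass from the basis to an arbitrary s, use `o` at a basis vector on which ω does not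
    -- vanish.
    have hne : ∃ i, w.components b e (e p) i ≠ 0 := by
      by_contra! hc
      refine hind e he _ ht ?_
      rw [show w.components b e (e p) = 0 from funext hc, map_zero, LinearMap.zero_apply]
    obtain ⟨i, hi⟩ := hne
    have h0 : η ![A v, b i] = 0 := congrFun hγ i
    have h1 := o (b i) s
    rw [h0, mul_zero] at h1
    exact (mul_eq_zero.1 h1).resolve_left hi
  change lam.d.toModel p ![(v : E), (u : E)] = 0
  rw [lam.d.toModel_eq he hp, ContinuousAlternatingMap.compContinuousLinearMap_apply,
    ← hzero (A u)]
  congr 1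
  ext i
  fin_cases i <;> rfl

end Pairs
-- Flatness and closedness of λ.
section Flat

variable {𝕜 : Type*} [RCLike 𝕜] {E : Type*} [NormedAddCommGroup E] [NormedSpace 𝕜 E]
  {M : Type*} [TopologicalSpace M] [ChartedSpace E M]
  {e : OpenPartialHomeomorph M E} {w w₁ lam : DiffForm 𝕜 E M 1} {Ω : DiffForm 𝕜 E M 3}
  {Λ Λ₁ : BivectorField 𝕜 E M}

/-- Where a bi-vector has constant coefficients, the `1`-form representing it is proportional, by
the density of the volume form, to a constant one. -/
theorem Represents.exists_components_eq_density_smul [FiniteDimensional 𝕜 E]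
    (hrep : Represents w Ω Λ) (b : Module.Basis (Fin 3) 𝕜 E)
    (he : e ∈ IsManifold.maximalAtlas 𝓘(𝕜, E) ∞ M)
    {c : (E →L[𝕜] 𝕜) [⋀^Fin 2]→L[𝕜] 𝕜} (hc : ∀ y ∈ e.target, Λ.inChart e y = c) :
    ∃ k : Fin 3 → 𝕜, ∀ y ∈ e.target, w.components b e y = Ω.density b e y • k := by
  let x : Fin 3 → E →L[𝕜] 𝕜 := fun i => covectorOfCoords b (Pi.single i 1)
  -- Evaluating the representation on pairs from the dual basis isolates the components of the form
  -- one at a time.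
  refine ⟨![c ![x 1, x 2], c ![x 2, x 0], c ![x 0, x 1]], fun y hy => ?_⟩
  have h := fun i j => hrep.triple_components b he hy (x i) (x j)
  simp only [x, covectorCoords_covectorOfCoords, hc y hy] at h
  have h0 := h 1 2
  have h1 := h 2 0
  have h2 := h 0 1
  simp only [triple_apply] at h0 h1 h2
  ext i
  fin_cases i
  · simpa [mul_comm, x] using h0
  · simpa [mul_comm, x] using h1
  · simpa [mul_comm, x] using h2

/-- L is the logarithmic derivative of ρ, handled without a logarithm: 0 = curl (ρL) = ρ curl L + ρ
(L ⨯ L). -/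
theorem curl_eq_zero_of_smul_eq_grad (b : Fin 3 → E) {ρ : E → 𝕜} {L : E → Fin 3 → 𝕜} {y : E}
    (hρ : ContDiffAt 𝕜 ∞ ρ y) (hρ0 : ρ y ≠ 0) (hL : DifferentiableAt 𝕜 L y)
    (h : ∀ᶠ z in 𝓝 y, ρ z • L z = grad b ρ z) : curl b L y = 0 := by
  have h1 := curl_grad b (hρ.of_le two_le_infty)
  rw [← curl_eventuallyEq b h, curl_smul b (hρ.differentiableAt (by simp)) hL,
    ← h.self_of_nhds, map_smul, LinearMap.smul_apply, cross_self, smul_zero, add_zero] at h1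
  exact (smul_eq_zero.1 h1).resolve_left hρ0

theorem trans_mem_maximalAtlas [IsManifold 𝓘(𝕜, E) ∞ M]
    (he : e ∈ IsManifold.maximalAtlas 𝓘(𝕜, E) ∞ M)
    {Φ : OpenPartialHomeomorph E E} (hΦ : ContDiffOn 𝕜 ∞ Φ Φ.source)
    (hΦs : ContDiffOn 𝕜 ∞ Φ.symm Φ.target) :
    e.trans Φ ∈ IsManifold.maximalAtlas 𝓘(𝕜, E) ∞ M := by
  apply OpenPartialHomeomorph.mem_maximalAtlas_of_contMDiffOn
  · rw [OpenPartialHomeomorph.coe_trans, OpenPartialHomeomorph.trans_source]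
    exact hΦ.contMDiffOn.comp ((contMDiffOn_of_mem_maximalAtlas he).mono Set.inter_subset_left)
      fun q hq => hq.2
  · rw [OpenPartialHomeomorph.coe_trans_symm, OpenPartialHomeomorph.trans_target]
    exact (contMDiffOn_symm_of_mem_maximalAtlas he).comp
      (hΦs.contMDiffOn.mono Set.inter_subset_left) fun q hq => hq.2

theorem chartDeriv_trans (he : e ∈ IsManifold.maximalAtlas 𝓘(𝕜, E) ∞ M)
    {Φ : OpenPartialHomeomorph E E} {q : M} (hq : q ∈ e.source)
    (hΦ : DifferentiableAt 𝕜 Φ (e q)) :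
    chartDeriv (𝕜 := 𝕜) (e.trans Φ) q = (fderiv 𝕜 Φ (e q)).comp (chartDeriv e q) := by
  rw [← mfderiv_eq_fderiv]
  exact mfderiv_comp q hΦ.mdifferentiableAt
    ((mdifferentiable_of_mem_maximalAtlas he).mdifferentiableAt hq)

theorem bivector_ext {c c' : (E →L[𝕜] 𝕜) [⋀^Fin 2]→L[𝕜] 𝕜}
    (h : ∀ α β, c ![α, β] = c' ![α, β]) : c = c' := by
  ext v
  have hv : v = ![v 0, v 1] := by
    ext i : 1
    fin_cases i <;> rfl
  rw [hv, h]

variable [FiniteDimensional 𝕜 E] [IsManifold 𝓘(𝕜, E) ∞ M]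

/-- In flat coordinates ω = ρk with k constant, so ρλ ∧ ω = dρ ∧ ω, and likewise for ω₁.
Independence gives ρλ = dρ. -/
theorem d_eq_zero_of_isFlat (b : Module.Basis (Fin 3) 𝕜 E)
    (hw : w.IsSmooth) (hw₁ : w₁.IsSmooth) (hΩ : Ω.IsSmooth) (hΩ0 : ∀ p, Ω p ≠ 0)
    (hrep : Represents w Ω Λ) (hrep₁ : Represents w₁ Ω Λ₁)
    (hind : ∀ e ∈ IsManifold.maximalAtlas 𝓘(𝕜, E) ∞ M, ∀ y ∈ e.target,
      w.components b e y ⨯₃ w₁.components b e y ≠ 0) (hlam : lam.IsSmooth)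
    (h : ∀ p, w.d p = wedge (lam.covector p) (w p))
    (h₁ : ∀ p, w₁.d p = wedge (lam.covector p) (w₁ p)) (hflat : IsFlat Λ Λ₁) (p : M) :
    lam.d p = 0 := by
  obtain ⟨e, he, hp, c, c₁, hc⟩ := hflat p
  have ht := e.map_source hp
  rw [hlam.d_eq_zero_iff b he hp]
  have hρ := hΩ.contDiffOn_density b he
  have key : ∀ {w : DiffForm 𝕜 E M 1} {Λ : BivectorField 𝕜 E M}
      {c : (E →L[𝕜] 𝕜) [⋀^Fin 2]→L[𝕜] 𝕜}, w.IsSmooth → Represents w Ω Λ →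
      (∀ p, w.d p = wedge (lam.covector p) (w p)) → (∀ y ∈ e.target, Λ.inChart e y = c) →
      ∀ y ∈ e.target, (Ω.density b e y • lam.components b e y) ⨯₃ w.components b e y =
        grad b (Ω.density b e) y ⨯₃ w.components b e y := by
    intro w Λ c hw hrep h hc y hy
    obtain ⟨k, hk⟩ := hrep.exists_components_eq_density_smul b he hc
    have h1 := (hw.d_eq_wedge_iff b he (e.map_target hy)).1 (h _)
    have hev : w.components b e =ᶠ[𝓝 y] fun z => Ω.density b e z • k := by
      filter_upwards [e.open_target.mem_nhds hy] with z hz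
      exact hk z hz
    rw [e.right_inv hy, curl_eventuallyEq b hev,
      curl_smul b (differentiableAt_of_contDiffOn hρ e.open_target hy)
        (differentiableAt_const k), curl_const, smul_zero, zero_add] at h1
    rw [map_smul, LinearMap.smul_apply, ← h1, hk y hy, map_smul]
  refine curl_eq_zero_of_smul_eq_grad b (hρ.contDiffAt (e.open_target.mem_nhds ht))
    (density_ne_zero b hΩ0 he ht)
    (differentiableAt_of_contDiffOn (hlam.contDiffOn_components b he) e.open_target ht) ?_
  filter_upwards [e.open_target.mem_nhds ht] with z hz
  exact cross_right_unique (hind e he z hz) (key hw hrep h (fun y hy => (hc y hy).1) z hz)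
    (key hw₁ hrep₁ h₁ (fun y hy => (hc y hy).2) z hz)

/-- The flat coordinates are a chart followed by the map of `exists_normalForm`; the density appears
on both sides of its conclusion and cancels. -/
theorem isFlat_of_d_eq_zero (b : Module.Basis (Fin 3) 𝕜 E)
    (hw : w.IsSmooth) (hw₁ : w₁.IsSmooth) (hΩ : Ω.IsSmooth) (hΩ0 : ∀ p, Ω p ≠ 0)
    (hrep : Represents w Ω Λ) (hrep₁ : Represents w₁ Ω Λ₁)
    (hind : ∀ e ∈ IsManifold.maximalAtlas 𝓘(𝕜, E) ∞ M, ∀ y ∈ e.target,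
      w.components b e y ⨯₃ w₁.components b e y ≠ 0) (hlam : lam.IsSmooth)
    (h : ∀ p, w.d p = wedge (lam.covector p) (w p))
    (h₁ : ∀ p, w₁.d p = wedge (lam.covector p) (w₁ p)) (hclosed : ∀ p, lam.d p = 0) :
    IsFlat Λ Λ₁ := by
  intro p
  have he := IsManifold.chart_mem_maximalAtlas (I := 𝓘(𝕜, E)) (n := ∞) p
  have hp := mem_chart_source E p
  set e := chartAt E p
  have ht := e.map_source hp
  obtain ⟨Φ, hpΦ, hsub, hΦ, hΦs, hnf⟩ := exists_normalForm b e.open_target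
    (hw.contDiffOn_components b he) (hw₁.contDiffOn_components b he)
    (hlam.contDiffOn_components b he) (hΩ.contDiffOn_density b he)
    (fun y hy => density_ne_zero b hΩ0 he hy)
    (fun y hy => by
      have := (hw.d_eq_wedge_iff b he (e.map_target hy)).1 (h _)
      rwa [e.right_inv hy] at this)
    (fun y hy => by
      have := (hw₁.d_eq_wedge_iff b he (e.map_target hy)).1 (h₁ _)
      rwa [e.right_inv hy] at this)
    (fun y hy => by
      have := (hlam.d_eq_zero_iff b he (e.map_target hy)).1 (hclosed _)
      rwa [e.right_inv hy] at this) ht (hind e he _ ht)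
  have key : ∀ {w : DiffForm 𝕜 E M 1} {Λ : BivectorField 𝕜 E M}
      {σ : (E →L[𝕜] 𝕜) → (E →L[𝕜] 𝕜) → 𝕜}, Represents w Ω Λ →
      (∀ y ∈ Φ.source, ∀ α β : E →L[𝕜] 𝕜,
        triple (covectorCoords b (α.comp (fderiv 𝕜 Φ y)))
          (covectorCoords b (β.comp (fderiv 𝕜 Φ y))) (w.components b e y) =
            σ α β * Ω.density b e y) →
      ∀ y ∈ (e.trans Φ).target, ∀ α β, Λ.inChart (e.trans Φ) y ![α, β] = σ α β := by
    intro w Λ σ hrep hσ y hy α β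
    rw [OpenPartialHomeomorph.trans_target] at hy
    have hz : Φ.symm y ∈ Φ.source := Φ.map_target hy.1
    have hze : Φ.symm y ∈ e.target := hy.2
    have h1 := hσ _ hz α β
    rw [hrep.triple_components b he hze] at h1
    rw [← mul_right_cancel₀ (density_ne_zero b hΩ0 he hze) h1, BivectorField.inChart_apply,
      BivectorField.inChart_apply, OpenPartialHomeomorph.coe_trans_symm, Function.comp_apply,
      chartDeriv_trans he (e.map_target hze)]
    · rw [e.right_inv hze]
      rfl
    · rw [e.right_inv hze]
      exact differentiableAt_of_contDiffOn hΦ Φ.open_source hz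
  have hmem := trans_mem_maximalAtlas he hΦ hΦs
  have hps : p ∈ (e.trans Φ).source := by
    rw [OpenPartialHomeomorph.trans_source]
    exact ⟨hp, hpΦ⟩
  have htarget := (e.trans Φ).map_source hps
  -- The constants are the values at the image of `p`; `key` shows that all other values agree with
  -- them.
  refine ⟨e.trans Φ, hmem, hps, Λ.inChart (e.trans Φ) (e.trans Φ p),
    Λ₁.inChart (e.trans Φ) (e.trans Φ p), fun y hy => ⟨bivector_ext fun α β => ?_,
      bivector_ext fun α β => ?_⟩⟩
  · have := key (σ := fun α β => α (b 1) * β (b 2) - α (b 2) * β (b 1)) hrep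
      fun y hy α β => (hnf y hy α β).1
    rw [this y hy, this _ htarget]
  · have := key (σ := fun α β => α (b 2) * β (b 0) - α (b 0) * β (b 2)) hrep₁
      fun y hy α β => (hnf y hy α β).2
    rw [this y hy, this _ htarget]

end Flat
end BiHam

/-! ### The theorem, assembled for a chosen basis of `E`. -/

open BiHam in
theorem proposition2 {𝕜 : Type*} [RCLike 𝕜]
    {E : Type*} [NormedAddCommGroup E] [NormedSpace 𝕜 E] (hE : Module.finrank 𝕜 E = 3)
    {M : Type*} [TopologicalSpace M] [ChartedSpace E M] [IsManifold 𝓘(𝕜, E) ∞ M]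
    (Λ Λ₁ : BivectorField 𝕜 E M) (hΛ : Λ.IsPoisson) (hΛ₁ : Λ₁.IsPoisson)
    (hgen : IsGeneric Λ Λ₁)
    (w w₁ : DiffForm 𝕜 E M 1) (Ω : DiffForm 𝕜 E M 3)
    (hw : w.IsSmooth) (hw₁ : w₁.IsSmooth) (hΩ : Ω.IsSmooth) (hΩ0 : ∀ p, Ω p ≠ 0)
    (hrep : Represents w Ω Λ) (hrep₁ : Represents w₁ Ω Λ₁) :
    ((∃ lam : DiffForm 𝕜 E M 1, lam.IsSmooth ∧
        (∀ p, w.d p = wedge (lam.covector p) (w p)) ∧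
        (∀ p, w₁.d p = wedge (lam.covector p) (w₁ p))) ↔
      IsPoissonPair Λ Λ₁) ∧
    ∀ lam : DiffForm 𝕜 E M 1, lam.IsSmooth →
      (∀ p, w.d p = wedge (lam.covector p) (w p)) →
      (∀ p, w₁.d p = wedge (lam.covector p) (w₁ p)) →
      (∀ p, Λ.im p ∩ Λ₁.im p ⊆ lam.d.ker p) ∧
      ((∀ p, lam.d p = 0) ↔ IsFlat Λ Λ₁) := by
  have : FiniteDimensional 𝕜 E := FiniteDimensional.of_finrank_pos (by omega)
  let b : Module.Basis (Fin 3) 𝕜 E := Module.finBasisOfFinrankEq 𝕜 E hE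
  have hind := fun (e : OpenPartialHomeomorph M E)
    (he : e ∈ IsManifold.maximalAtlas 𝓘(𝕜, E) ∞ M) (y : E) (hy : y ∈ e.target) =>
      hgen.cross_components_ne_zero hrep hrep₁ b hΩ0 he hy
  refine ⟨⟨fun ⟨lam, _, h, h₁⟩ =>
    isPoissonPair_of_d_eq_wedge b hΛ hΛ₁ hw hw₁ hΩ hΩ0 hrep hrep₁ h h₁, fun hpair =>
    exists_d_eq_wedge_of_isPoissonPair b hpair hw hw₁ hΩ hΩ0 hrep hrep₁ hind⟩,
    fun lam hlam h h₁ => ⟨im_inter_im_subset_ker_d b hw hw₁ hlam hΩ0 hrep hrep₁ hind h h₁,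
      isFlat_of_d_eq_zero b hw hw₁ hΩ hΩ0 hrep hrep₁ hind hlam h h₁,
      d_eq_zero_of_isFlat b hw hw₁ hΩ hΩ0 hrep hrep₁ hind hlam h h₁⟩⟩
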